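/- Let $P=\mathbb C[O_1,O_2,O_3,O_4,O_5,O_6,O_{12},O_{23},O_{34},O_{45},O_{56},O_{61},O_{123},O_{234},O_{345}]$ be the polynomial ring in 15 variables. Indices are read modulo $6$ (with representatives $1,\dots,6$), and $O_{456}=O_{123}$, $O_{561}=O_{234}$, $O_{612}=O_{345}$. Let $\mathcal I_{q=t=1}\subset P$ be the defining ideal of $\mathcal A_{q=t=1}=P/\mathcal I_{q=t=1}$, that is, the ideal generated by the following 19 polynomials: for $1\le i\le 6$, \begin{align*} &O_{i+2}O_{i+4}+O_{i+3}O_{i+2,i+3,i+4}-O_{i+2,i+3}O_{i+3,i+4}-2O_i,\\ &-O_{i+3}O_{i+5,i}-O_{i+4}O_{i+1,i+2}+O_{i+3,i+4}O_{i+1,i+2,i+3}-2\left(O_{i,i+1}-O_iO_{i+1}\right),\\ &-O_{i+1,i+2}O_{i+4,i+5}+O_{i,i+1,i+2}O_{i+1,i+2,i+3}-O_iO_{i+3}\\ &\qquad-2\left(-O_{i+2,i+3,i+4}+O_{i+1}O_{i+5,i}+O_{i+5}O_{i,i+1}-O_iO_{i+1}O_{i+5}\right), \end{align*} together with \begin{align*}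 &O_{123}O_{234}O_{345}-\left(O_1O_4O_{345}+O_2O_5O_{123}+O_3O_6O_{234}\right)\\ &+\left(O_1O_6O_{61}+O_2O_1O_{12}+O_3O_2O_{23}+O_4O_3O_{34}+O_5O_4O_{45}+O_6O_5O_{56}\right)\\ &-\left(O_1O_3O_5+O_2O_4O_6\right)-\left(O_{12}^2+O_{23}^2+O_{34}^2+O_{45}^2+O_{56}^2+O_{61}^2\right)+8. \end{align*} Give $O_i$ weight $2$, $O_{i,i+1}$ weight $3$ and $O_{i,i+1,i+2}$ weight $4$, and order the variables as listed in the definition of $P$. In the weighted degree reverse lexicographic order a monomial $a$ is smaller than a monomial $b$ if its weighted degree is smaller, or if the weighted degrees agree and, at the last variable in which the exponents of $a$ and $b$ differ, the exponent in $a$ is the larger one. Then the 61 polynomials $g_1|_{q=t=1},\dots,g_{61}|_{q=t=1}$ listed below form a normalized Groebner basis of $\mathcal I_{q=t=1}$ with respect to this order: they lie in $\mathcal I_{q=t=1}$, their leading terms generate the ideal generated by the leading terms of all elements of $\mathcal I_{q=t=1}$, each of them has leading coefficient $1$, and no monomial occurring in one of them is divisible by the leading monomial of another. \begin{align*} g_{1}|_{q=t=1}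 ={}& O_{56}O_{61}-O_{6}O_{234}-O_{1}O_{5}+2O_{3},\\ g_{2}|_{q=t=1} ={}& O_{12}O_{61}-O_{1}O_{345}-O_{2}O_{6}+2O_{4},\\ g_{3}|_{q=t=1} ={}& O_{45}O_{56}-O_{5}O_{123}-O_{4}O_{6}+2O_{2},\\ g_{4}|_{q=t=1} ={}& O_{34}O_{45}-O_{4}O_{345}-O_{3}O_{5}+2O_{1},\\ g_{5}|_{q=t=1} ={}& O_{23}O_{34}-O_{3}O_{234}-O_{2}O_{4}+2O_{6},\\ g_{6}|_{q=t=1} ={}& O_{12}O_{23}-O_{2}O_{123}-O_{1}O_{3}+2O_{5},\\ g_{7}|_{q=t=1} ={}& O_{3}O_{4}O_{5}-O_{1}O_{2}O_{6}+O_{6}O_{12}-O_{5}O_{34}-O_{3}O_{45}+O_{2}O_{61},\\ g_{8}|_{q=t=1} ={}& O_{2}O_{3}O_{4}-O_{1}O_{5}O_{6}-O_{4}O_{23}-O_{2}O_{34}+O_{1}O_{56}+O_{5}O_{61},\\ g_{9}|_{q=t=1} ={}& O_{1}O_{2}O_{3}-O_{4}O_{5}O_{6}-O_{3}O_{12}-O_{1}O_{23}+O_{6}O_{45}+O_{4}O_{56},\\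 g_{10}|_{q=t=1} ={}& O_{56}O_{345}-O_{5}O_{12}-O_{6}O_{34}+2O_{2}O_{3}-2O_{23},\\ g_{11}|_{q=t=1} ={}& O_{23}O_{345}-O_{2}O_{45}-O_{3}O_{61}+2O_{5}O_{6}-2O_{56},\\ g_{12}|_{q=t=1} ={}& O_{45}O_{234}-O_{5}O_{23}-O_{4}O_{61}+2O_{1}O_{2}-2O_{12},\\ g_{13}|_{q=t=1} ={}& O_{12}O_{234}-O_{1}O_{34}-O_{2}O_{56}+2O_{4}O_{5}-2O_{45},\\ g_{14}|_{q=t=1} ={}& O_{61}O_{123}-O_{6}O_{23}-O_{1}O_{45}+2O_{3}O_{4}-2O_{34},\\ g_{15}|_{q=t=1} ={}& O_{34}O_{123}-O_{4}O_{12}-O_{3}O_{56}+2O_{1}O_{6}-2O_{61},\\ g_{16}|_{q=t=1} ={}& O_{3}O_{4}O_{34}-O_{1}O_{6}O_{61}-O_{34}^{2}+O_{61}^{2}+O_{1}^{2}-O_{3}^{2}-O_{4}^{2}+O_{6}^{2},\\ g_{17}|_{q=t=1} ={}& O_{2}O_{3}O_{23}-O_{5}O_{6}O_{56}-O_{23}^{2}+O_{56}^{2}-O_{2}^{2}-O_{3}^{2}+O_{5}^{2}+O_{6}^{2},\\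 g_{18}|_{q=t=1} ={}& O_{1}O_{2}O_{12}-O_{4}O_{5}O_{45}-O_{12}^{2}+O_{45}^{2}-O_{1}^{2}-O_{2}^{2}+O_{4}^{2}+O_{5}^{2},\\ g_{19}|_{q=t=1} ={}& O_{234}O_{345}+2O_{4}O_{5}O_{6}-O_{34}O_{61}-2O_{6}O_{45}-2O_{4}O_{56}-O_{2}O_{5}+2O_{123},\\ g_{20}|_{q=t=1} ={}& O_{123}O_{345}+2O_{1}O_{5}O_{6}-O_{12}O_{45}-2O_{1}O_{56}-2O_{5}O_{61}-O_{3}O_{6}+2O_{234},\\ g_{21}|_{q=t=1} ={}& O_{123}O_{234}+2O_{1}O_{2}O_{6}-O_{23}O_{56}-2O_{6}O_{12}-2O_{2}O_{61}-O_{1}O_{4}+2O_{345},\\ g_{22}|_{q=t=1} ={}& O_{4}O_{5}O_{6}^{2}-O_{6}^{2}O_{45}-O_{4}O_{6}O_{56}-O_{2}O_{3}O_{61}+O_{23}O_{61}+O_{6}O_{123}+O_{3}O_{345}-O_{4}O_{5},\\ g_{23}|_{q=t=1} ={}& O_{1}O_{2}O_{6}^{2}-O_{6}^{2}O_{12}-O_{3}O_{4}O_{56}-O_{2}O_{6}O_{61}+O_{34}O_{56}+O_{3}O_{123}+O_{6}O_{345}-O_{1}O_{2},\\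 g_{24}|_{q=t=1} ={}& O_{1}O_{5}^{2}O_{6}-O_{2}O_{3}O_{45}-O_{1}O_{5}O_{56}-O_{5}^{2}O_{61}+O_{23}O_{45}+O_{5}O_{234}+O_{2}O_{345}-O_{1}O_{6},\\ g_{25}|_{q=t=1} ={}& O_{4}^{2}O_{5}O_{6}-O_{1}O_{2}O_{34}-O_{4}O_{6}O_{45}-O_{4}^{2}O_{56}+O_{12}O_{34}+O_{4}O_{123}+O_{1}O_{234}-O_{5}O_{6},\\ g_{26}|_{q=t=1} ={}& O_{1}O_{4}O_{5}O_{6}-O_{1}O_{6}O_{45}-O_{1}O_{4}O_{56}-O_{4}O_{5}O_{61}+O_{45}O_{61}+O_{1}O_{123}+O_{4}O_{234}-O_{2}O_{3},\\ g_{27}|_{q=t=1} ={}& O_{1}O_{2}O_{5}O_{6}-O_{5}O_{6}O_{12}-O_{1}O_{2}O_{56}-O_{2}O_{5}O_{61}+O_{12}O_{56}+O_{2}O_{234}+O_{5}O_{345}-O_{3}O_{4},\\ g_{28}|_{q=t=1} ={}& O_{1}^{2}O_{5}O_{6}-O_{3}O_{4}O_{12}-O_{1}^{2}O_{56}-O_{1}O_{5}O_{61}+O_{12}O_{34}+O_{4}O_{123}+O_{1}O_{234}-O_{5}O_{6},\\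 g_{29}|_{q=t=1} ={}& O_{1}O_{2}^{2}O_{6}-O_{2}O_{6}O_{12}-O_{4}O_{5}O_{23}-O_{2}^{2}O_{61}+O_{23}O_{45}+O_{5}O_{234}+O_{2}O_{345}-O_{1}O_{6},\\ g_{30}|_{q=t=1} ={}& O_{1}O_{5}O_{6}O_{61}-O_{5}O_{61}^{2}-O_{1}O_{6}O_{234}-O_{3}O_{4}O_{345}+O_{61}O_{234}+O_{34}O_{345}-O_{1}^{2}O_{5}-O_{5}O_{6}^{2}+O_{4}O_{45}\\ &\quad +O_{6}O_{56}+2O_{1}O_{3},\\ g_{31}|_{q=t=1} ={}& O_{1}O_{2}O_{6}O_{61}-O_{2}O_{61}^{2}-O_{3}O_{4}O_{234}-O_{1}O_{6}O_{345}+O_{34}O_{234}+O_{61}O_{345}-O_{1}^{2}O_{2}-O_{2}O_{6}^{2}+O_{1}O_{12}\\ &\quad +O_{3}O_{23}+2O_{4}O_{6},\\ g_{32}|_{q=t=1} ={}& O_{4}O_{5}O_{6}O_{56}-O_{4}O_{56}^{2}-O_{5}O_{6}O_{123}-O_{2}O_{3}O_{234}+O_{56}O_{123}+O_{23}O_{234}-O_{4}O_{5}^{2}-O_{4}O_{6}^{2}+O_{3}O_{34}\\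 &\quad +O_{5}O_{45}+2O_{2}O_{6},\\ g_{33}|_{q=t=1} ={}& O_{1}O_{5}O_{6}O_{56}-O_{1}O_{56}^{2}-O_{2}O_{3}O_{123}-O_{5}O_{6}O_{234}+O_{23}O_{123}+O_{56}O_{234}-O_{1}O_{5}^{2}-O_{1}O_{6}^{2}+O_{2}O_{12}\\ &\quad +O_{6}O_{61}+2O_{3}O_{5},\\ g_{34}|_{q=t=1} ={}& O_{4}O_{5}O_{6}O_{45}-O_{6}O_{45}^{2}-O_{4}O_{5}O_{123}-O_{1}O_{2}O_{345}+O_{45}O_{123}+O_{12}O_{345}-O_{4}^{2}O_{6}-O_{5}^{2}O_{6}+O_{5}O_{56}\\ &\quad +O_{1}O_{61}+2O_{2}O_{4},\\ g_{35}|_{q=t=1} ={}& O_{1}O_{2}O_{6}O_{45}-O_{6}O_{12}O_{45}-O_{2}O_{45}O_{61}-O_{1}O_{2}O_{123}+O_{12}O_{123}+O_{45}O_{345}-O_{3}O_{4}^{2}+O_{2}O_{23}+O_{4}O_{34},\\ g_{36}|_{q=t=1} ={}& O_{5}O_{6}^{2}O_{34}-O_{2}O_{3}^{2}O_{61}-O_{6}O_{34}O_{56}+O_{3}O_{23}O_{61}+O_{3}^{2}O_{345}-O_{6}^{2}O_{345}+O_{6}O_{12}-O_{5}O_{34}-O_{3}O_{45}\\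 &\quad +O_{2}O_{61},\\ g_{37}|_{q=t=1} ={}& O_{1}O_{5}O_{6}O_{34}-O_{1}O_{34}O_{56}-O_{5}O_{34}O_{61}-O_{1}O_{6}O_{345}+O_{34}O_{234}+O_{61}O_{345}-O_{2}O_{3}^{2}+O_{1}O_{12}+O_{3}O_{23},\\ g_{38}|_{q=t=1} ={}& O_{1}O_{2}O_{6}O_{34}-O_{6}O_{12}O_{34}-O_{2}O_{34}O_{61}-O_{1}O_{6}O_{234}+O_{61}O_{234}+O_{34}O_{345}-O_{4}^{2}O_{5}+O_{4}O_{45}+O_{6}O_{56},\\ g_{39}|_{q=t=1} ={}& O_{1}^{2}O_{2}O_{34}-O_{4}^{2}O_{5}O_{61}-O_{1}O_{12}O_{34}+O_{4}O_{45}O_{61}-O_{1}^{2}O_{234}+O_{4}^{2}O_{234}-O_{4}O_{23}-O_{2}O_{34}+O_{1}O_{56}\\ &\quad +O_{5}O_{61},\\ g_{40}|_{q=t=1} ={}& O_{1}O_{6}^{2}O_{23}-O_{3}^{2}O_{4}O_{56}+O_{3}O_{34}O_{56}-O_{6}O_{23}O_{61}+O_{3}^{2}O_{123}-O_{6}^{2}O_{123}-O_{3}O_{12}-O_{1}O_{23}+O_{6}O_{45}\\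 &\quad +O_{4}O_{56},\\ g_{41}|_{q=t=1} ={}& O_{4}O_{5}O_{6}O_{23}-O_{6}O_{23}O_{45}-O_{4}O_{23}O_{56}-O_{5}O_{6}O_{234}+O_{23}O_{123}+O_{56}O_{234}-O_{1}O_{2}^{2}+O_{2}O_{12}+O_{6}O_{61},\\ g_{42}|_{q=t=1} ={}& O_{1}O_{5}O_{6}O_{23}-O_{1}O_{23}O_{56}-O_{5}O_{23}O_{61}-O_{5}O_{6}O_{123}+O_{56}O_{123}+O_{23}O_{234}-O_{3}^{2}O_{4}+O_{3}O_{34}+O_{5}O_{45},\\ g_{43}|_{q=t=1} ={}& O_{4}O_{5}^{2}O_{23}-O_{1}O_{2}^{2}O_{56}-O_{5}O_{23}O_{45}+O_{2}O_{12}O_{56}+O_{2}^{2}O_{234}-O_{5}^{2}O_{234}-O_{4}O_{23}-O_{2}O_{34}+O_{1}O_{56}\\ &\quad +O_{5}O_{61},\\ g_{44}|_{q=t=1} ={}& O_{5}^{2}O_{6}O_{12}-O_{2}^{2}O_{3}O_{45}+O_{2}O_{23}O_{45}-O_{5}O_{12}O_{56}+O_{2}^{2}O_{345}-O_{5}^{2}O_{345}-O_{6}O_{12}+O_{5}O_{34}+O_{3}O_{45}\\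 &\quad -O_{2}O_{61},\\ g_{45}|_{q=t=1} ={}& O_{4}O_{5}O_{6}O_{12}-O_{6}O_{12}O_{45}-O_{4}O_{12}O_{56}-O_{4}O_{5}O_{345}+O_{12}O_{123}+O_{45}O_{345}-O_{2}^{2}O_{3}+O_{2}O_{23}+O_{4}O_{34},\\ g_{46}|_{q=t=1} ={}& O_{3}O_{4}^{2}O_{12}-O_{1}^{2}O_{6}O_{45}-O_{4}O_{12}O_{34}+O_{1}O_{45}O_{61}+O_{1}^{2}O_{123}-O_{4}^{2}O_{123}-O_{3}O_{12}-O_{1}O_{23}+O_{6}O_{45}\\ &\quad +O_{4}O_{56},\\ g_{47}|_{q=t=1} ={}& O_{1}O_{2}O_{6}O_{345}-O_{6}O_{12}O_{345}-O_{2}O_{61}O_{345}+O_{345}^{2}-O_{4}O_{5}O_{45}-O_{1}O_{6}O_{61}+O_{45}^{2}+O_{61}^{2}+O_{5}^{2}\\ &\quad +O_{6}^{2}-4,\\ g_{48}|_{q=t=1} ={}& O_{1}O_{5}O_{6}O_{234}-O_{1}O_{56}O_{234}-O_{5}O_{61}O_{234}+O_{234}^{2}-O_{5}O_{6}O_{56}-O_{1}O_{6}O_{61}+O_{56}^{2}+O_{61}^{2}+O_{1}^{2}\\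 &\quad -O_{3}^{2}+O_{5}^{2}+O_{6}^{2}-4,\\ g_{49}|_{q=t=1} ={}& O_{4}O_{5}O_{6}O_{123}-O_{6}O_{45}O_{123}-O_{4}O_{56}O_{123}+O_{123}^{2}-O_{4}O_{5}O_{45}-O_{5}O_{6}O_{56}+O_{45}^{2}+O_{56}^{2}-O_{2}^{2}\\ &\quad +O_{4}^{2}+O_{5}^{2}+O_{6}^{2}-4,\\ g_{50}|_{q=t=1} ={}& O_{1}O_{6}O_{45}O_{61}-O_{3}O_{4}^{2}O_{345}-O_{45}O_{61}^{2}+O_{4}O_{34}O_{345}-O_{1}O_{6}O_{23}-O_{1}^{2}O_{45}+O_{4}^{2}O_{45}-O_{6}^{2}O_{45}+2O_{1}O_{3}O_{4}\\ &\quad +O_{23}O_{61}+O_{6}O_{123}+O_{3}O_{345}-2O_{1}O_{34}-O_{4}O_{5},\\ g_{51}|_{q=t=1} ={}& O_{4}O_{5}O_{45}O_{61}-O_{1}^{2}O_{2}O_{345}-O_{45}^{2}O_{61}+O_{1}O_{12}O_{345}-O_{4}O_{5}O_{23}+O_{1}^{2}O_{61}-O_{4}^{2}O_{61}-O_{5}^{2}O_{61}+2O_{1}O_{2}O_{4}\\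 &\quad +O_{23}O_{45}+O_{5}O_{234}+O_{2}O_{345}-2O_{4}O_{12}-O_{1}O_{6},\\ g_{52}|_{q=t=1} ={}& O_{2}O_{3}O_{45}O_{61}-O_{23}O_{45}O_{61}-O_{3}O_{45}O_{345}-O_{2}O_{61}O_{345}-O_{5}^{2}O_{6}^{2}+O_{345}^{2}+O_{5}O_{6}O_{56}+O_{45}^{2}+O_{61}^{2}\\ &\quad +O_{5}^{2}+O_{6}^{2}-4,\\ g_{53}|_{q=t=1} ={}& O_{1}O_{6}O_{23}O_{61}-O_{3}^{2}O_{4}O_{234}-O_{23}O_{61}^{2}+O_{3}O_{34}O_{234}-O_{1}^{2}O_{23}+O_{3}^{2}O_{23}-O_{6}^{2}O_{23}-O_{1}O_{6}O_{45}+2O_{3}O_{4}O_{6}\\ &\quad +O_{45}O_{61}+O_{1}O_{123}+O_{4}O_{234}-2O_{6}O_{34}-O_{2}O_{3},\\ g_{54}|_{q=t=1} ={}& O_{4}O_{5}O_{23}O_{61}-O_{23}O_{45}O_{61}-O_{4}O_{23}O_{234}-O_{5}O_{61}O_{234}-O_{1}^{2}O_{2}^{2}+O_{234}^{2}+O_{4}O_{5}O_{45}+O_{12}^{2}+O_{23}^{2}\\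 &\quad -O_{45}^{2}+O_{61}^{2}+2O_{1}^{2}+2O_{2}^{2}-O_{4}^{2}-O_{5}^{2}-4,\\ g_{55}|_{q=t=1} ={}& O_{5}O_{6}O_{34}O_{56}-O_{2}O_{3}^{2}O_{234}-O_{34}O_{56}^{2}+O_{3}O_{23}O_{234}-O_{5}O_{6}O_{12}+O_{3}^{2}O_{34}-O_{5}^{2}O_{34}-O_{6}^{2}O_{34}+2O_{2}O_{3}O_{6}\\ &\quad +O_{12}O_{56}+O_{2}O_{234}+O_{5}O_{345}-2O_{6}O_{23}-O_{3}O_{4},\\ g_{56}|_{q=t=1} ={}& O_{1}O_{2}O_{34}O_{56}-O_{12}O_{34}O_{56}-O_{2}O_{34}O_{234}-O_{1}O_{56}O_{234}-O_{4}^{2}O_{5}^{2}+O_{234}^{2}+O_{4}O_{5}O_{45}+O_{34}^{2}+O_{56}^{2}\\ &\quad +O_{4}^{2}+O_{5}^{2}-4,\\ g_{57}|_{q=t=1} ={}& O_{5}O_{6}O_{12}O_{56}-O_{2}^{2}O_{3}O_{123}-O_{12}O_{56}^{2}+O_{2}O_{23}O_{123}+O_{2}^{2}O_{12}-O_{5}^{2}O_{12}-O_{6}^{2}O_{12}-O_{5}O_{6}O_{34}+2O_{2}O_{3}O_{5}\\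 &\quad +O_{34}O_{56}+O_{3}O_{123}+O_{6}O_{345}-2O_{5}O_{23}-O_{1}O_{2},\\ g_{58}|_{q=t=1} ={}& O_{3}O_{4}O_{12}O_{56}-O_{12}O_{34}O_{56}-O_{3}O_{12}O_{123}-O_{4}O_{56}O_{123}-O_{1}^{2}O_{6}^{2}+O_{123}^{2}+O_{1}O_{6}O_{61}+O_{12}^{2}+O_{56}^{2}\\ &\quad +O_{1}^{2}+O_{6}^{2}-4,\\ g_{59}|_{q=t=1} ={}& O_{1}O_{6}O_{23}O_{45}-O_{23}O_{45}O_{61}-O_{1}O_{23}O_{123}-O_{6}O_{45}O_{123}-O_{3}^{2}O_{4}^{2}+O_{123}^{2}+O_{1}O_{6}O_{61}+O_{23}^{2}+O_{34}^{2}\\ &\quad +O_{45}^{2}-O_{61}^{2}-O_{1}^{2}+2O_{3}^{2}+2O_{4}^{2}-O_{6}^{2}-4,\\ g_{60}|_{q=t=1} ={}& O_{4}O_{5}O_{23}O_{45}-O_{1}O_{2}^{2}O_{123}-O_{23}O_{45}^{2}+O_{2}O_{12}O_{123}+O_{2}^{2}O_{23}-O_{4}^{2}O_{23}-O_{5}^{2}O_{23}-O_{4}O_{5}O_{61}+2O_{1}O_{2}O_{5}\\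 &\quad +O_{45}O_{61}+O_{1}O_{123}+O_{4}O_{234}-2O_{5}O_{12}-O_{2}O_{3},\\ g_{61}|_{q=t=1} ={}& O_{5}O_{6}O_{12}O_{34}-O_{12}O_{34}O_{56}-O_{6}O_{12}O_{345}-O_{5}O_{34}O_{345}-O_{2}^{2}O_{3}^{2}+O_{345}^{2}+O_{5}O_{6}O_{56}+O_{12}^{2}+O_{23}^{2}\\ &\quad +O_{34}^{2}-O_{56}^{2}+2O_{2}^{2}+2O_{3}^{2}-O_{5}^{2}-O_{6}^{2}-4. \end{align*} -/

import Mathlib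

open MvPolynomial

/-! ### The weighted degree reverse lexicographic order -/

section WeightedDegRevLex

variable {n : ℕ}

/-- The type of exponent vectors, to be ordered by weighted degree and then reverse
lexicographically, for the weights `w`. -/
def WDegRevLex (_w : Fin n → ℕ) : Type := Fin n →₀ ℕ

namespace WDegRevLex

noncomputable instance (w : Fin n → ℕ) : AddCommMonoid (WDegRevLex w) :=
  inferInstanceAs (AddCommMonoid (Fin n →₀ ℕ))

/-- The comparison key of an exponent vector `e`: its weighted degree, and then its exponents read
from the last variable to the first one, compared lexicographically with the order reversed. -/
noncomputable def key (w : Fin n → ℕ) (e : Fin n →₀ ℕ) : ℕ ×ₗ (Lex (Fin n → ℕ))ᵒᵈ :=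
  toLex (Finsupp.weight w e, OrderDual.toDual (toLex fun i => e i.rev))

theorem key_injective (w : Fin n → ℕ) : Function.Injective (key w) := by
  intro a b h
  have h2 := congrArg (fun x => (ofLex x).2) h
  have h3 : (fun i : Fin n => a i.rev) = fun i => b i.rev := h2
  ext i
  simpa using congrFun h3 i.rev

noncomputable instance (w : Fin n → ℕ) : LinearOrder (WDegRevLex w) :=
  LinearOrder.lift' (fun e : WDegRevLex w => key w e) (key_injective w)

/-- `a` is smaller than `b` if its weighted degree is smaller, or if the weighted degrees agree and,
at the last variable where the exponents differ, the exponent of `a` is the larger one. -/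
theorem key_lt_key_iff (w : Fin n → ℕ) (a b : Fin n →₀ ℕ) :
    key w a < key w b ↔ Finsupp.weight w a < Finsupp.weight w b ∨
      (Finsupp.weight w a = Finsupp.weight w b ∧
        ∃ i, (∀ j, i < j → a j = b j) ∧ b i < a i) := by
  unfold key
  rw [Prod.Lex.toLex_lt_toLex]
  refine or_congr Iff.rfl (and_congr Iff.rfl ?_)
  change toLex (fun i : Fin n => b i.rev) < toLex (fun i : Fin n => a i.rev) ↔ _
  constructor
  · rintro ⟨i, h1, h2⟩
    refine ⟨i.rev, fun j hj => ?_, h2⟩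
    have := h1 j.rev (Fin.rev_lt_iff.1 hj)
    simpa using this.symm
  · rintro ⟨i, h1, h2⟩
    refine ⟨i.rev, fun j hj => ?_, by simpa using h2⟩
    exact (h1 j.rev (Fin.lt_rev_iff.1 hj)).symm

theorem key_add_lt_key_add (w : Fin n → ℕ) {a b : Fin n →₀ ℕ} (h : key w a < key w b)
    (c : Fin n →₀ ℕ) : key w (a + c) < key w (b + c) := by
  rw [key_lt_key_iff] at h ⊢
  simpa using h

instance (w : Fin n → ℕ) : IsOrderedAddMonoid (WDegRevLex w) where
  add_le_add_left a b h c := by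
    rcases eq_or_lt_of_le h with h | h
    · rw [h]
    · exact le_of_lt (key_add_lt_key_add w (a := a) (b := b) h c)

theorem key_monotone (w : Fin n → ℕ) (hw : ∀ i, 0 < w i) : Monotone (key w) := by
  intro a b h
  obtain ⟨c, rfl⟩ := exists_add_of_le h
  by_cases hc : c = 0
  · simp [hc]
  · refine le_of_lt ((key_lt_key_iff w _ _).2 (Or.inl ?_))
    obtain ⟨i, hi⟩ := Finsupp.ne_iff.1 hc
    have := Finsupp.le_weight_of_ne_zero' w hi
    have := hw i
    rw [map_add]
    omega

end WDegRevLex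

/-- The weighted degree reverse lexicographic monomial order on the monomials in variables
`X 0 > X 1 > ⋯ > X (n - 1)` (among variables of equal weight), for positive weights `w`. -/
noncomputable def wDegRevLex (w : Fin n → ℕ) (hw : ∀ i, 0 < w i) : MonomialOrder (Fin n) where
  syn := WDegRevLex w
  toSyn := { Equiv.refl (Fin n →₀ ℕ) with map_add' := fun _ _ => rfl }
  toSyn_monotone := fun _ _ h => WDegRevLex.key_monotone w hw h
  wellFoundedLT_syn := by
    let f : (Fin n →₀ ℕ) → WDegRevLex w := fun e => e
    have hf : Monotone f := fun _ _ h => WDegRevLex.key_monotone w hw h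
    have := hf.wellQuasiOrderedLE_of_wellQuasiOrderedLE_of_surjective fun e => ⟨e, rfl⟩
    exact WellQuasiOrderedLE.to_wellFoundedLT

open scoped MonomialOrder in
theorem wDegRevLex_lt_iff (w : Fin n → ℕ) (hw : ∀ i, 0 < w i) (a b : Fin n →₀ ℕ) :
    a ≺[wDegRevLex w hw] b ↔ Finsupp.weight w a < Finsupp.weight w b ∨
      (Finsupp.weight w a = Finsupp.weight w b ∧
        ∃ i, (∀ j, i < j → a j = b j) ∧ b i < a i) :=
  WDegRevLex.key_lt_key_iff w a b

end WeightedDegRevLex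

/-! ### Groebner bases -/

/-- The family `g` is a normalized Groebner basis of the ideal `I` for the monomial order `m`: its
members lie in `I`, their leading terms generate the ideal of leading terms of `I`, all of their
leading coefficients are `1`, and no monomial of a member is divisible by the leading monomial of
another member. -/
structure IsNormalizedGroebnerBasis {σ K ι : Type*} [Field K] (m : MonomialOrder σ)
    (I : Ideal (MvPolynomial σ K)) (g : ι → MvPolynomial σ K) : Prop where
  mem : ∀ i, g i ∈ I
  span_leadingTerm : Ideal.span (m.leadingTerm '' Set.range g) =
    Ideal.span (m.leadingTerm '' (I : Set (MvPolynomial σ K)))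
  monic : ∀ i, m.Monic (g i)
  reduced : ∀ i j, i ≠ j → ∀ d ∈ (g j).support, ¬ m.degree (g i) ≤ d

namespace GenusTwo

/-! ### The polynomial ring in 15 variables and its monomial order -/

/-- The polynomial ring over `ℂ` in the 15 variables `O₁, …, O₆, O₁₂, …, O₆₁, O₁₂₃, O₂₃₄, O₃₄₅`,
numbered in this order. -/
abbrev P : Type := MvPolynomial (Fin 15) ℂ

noncomputable section

/-- The generator `O_1`. -/
abbrev O₁ : P := X 0

/-- The generator `O_2`. -/
abbrev O₂ : P := X 1

/-- The generator `O_3`. -/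
abbrev O₃ : P := X 2

/-- The generator `O_4`. -/
abbrev O₄ : P := X 3

/-- The generator `O_5`. -/
abbrev O₅ : P := X 4

/-- The generator `O_6`. -/
abbrev O₆ : P := X 5

/-- The generator `O_12`. -/
abbrev O₁₂ : P := X 6

/-- The generator `O_23`. -/
abbrev O₂₃ : P := X 7

/-- The generator `O_34`. -/
abbrev O₃₄ : P := X 8

/-- The generator `O_45`. -/
abbrev O₄₅ : P := X 9

/-- The generator `O_56`. -/
abbrev O₅₆ : P := X 10

/-- The generator `O_61`. -/
abbrev O₆₁ : P := X 11

/-- The generator `O_123`. -/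
abbrev O₁₂₃ : P := X 12

/-- The generator `O_234`. -/
abbrev O₂₃₄ : P := X 13

/-- The generator `O_345`. -/
abbrev O₃₄₅ : P := X 14

/-- The weights of the variables: `2` for `O_i`, `3` for `O_{i,i+1}`, `4` for `O_{i,i+1,i+2}`. -/
def weights : Fin 15 → ℕ := ![2, 2, 2, 2, 2, 2, 3, 3, 3, 3, 3, 3, 4, 4, 4]

theorem weights_pos : ∀ i, 0 < weights i := by decide

/-- The weighted degree reverse lexicographic order on the monomials of `P`. -/
def order : MonomialOrder (Fin 15) := wDegRevLex weights weights_pos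

/-! ### The defining ideal at `q = t = 1` -/

/-- `O i` is `O_{i+1}`: the indices are residues modulo 6, and `0 : Fin 6` stands for the
index 1. -/
def O : Fin 6 → P := ![O₁, O₂, O₃, O₄, O₅, O₆]

/-- `OO i` is the variable with the two cyclically consecutive indices starting at that of
`O i`. -/
def OO : Fin 6 → P := ![O₁₂, O₂₃, O₃₄, O₄₅, O₅₆, O₆₁]

/-- `OOO i` is the variable with the three cyclically consecutive indices starting at that of
`O i`, where `O₄₅₆ = O₁₂₃`, `O₅₆₁ = O₂₃₄` and `O₆₁₂ = O₃₄₅`. -/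
def OOO : Fin 6 → P := ![O₁₂₃, O₂₃₄, O₃₄₅, O₁₂₃, O₂₃₄, O₃₄₅]

/-- The first family of J-relators at `q = t = 1`, where `t^(1/2) + t^(-1/2) = 2`. -/
def relJ1 (i : Fin 6) : P :=
  O (i + 2) * O (i + 4) + O (i + 3) * OOO (i + 2) - OO (i + 2) * OO (i + 3) - 2 * O i

/-- The second family of J-relators at `q = t = 1`. -/
def relJ2 (i : Fin 6) : P :=
  -(O (i + 3) * OO (i + 5)) - O (i + 4) * OO (i + 1) + OO (i + 3) * OOO (i + 1)
    - 2 * (OO i - O i * O (i + 1))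

/-- The third family of J-relators at `q = t = 1`. -/
def relJ3 (i : Fin 6) : P :=
  -(OO (i + 1) * OO (i + 4)) + OOO i * OOO (i + 1) - O i * O (i + 3)
    - 2 * (-OOO (i + 2) + O (i + 1) * OO (i + 5) + O (i + 5) * OO i - O i * O (i + 1) * O (i + 5))

/-- The Casimir relator at `q = t = 1`. -/
def relCasimir : P :=
  O₁₂₃ * O₂₃₄ * O₃₄₅ - (O₁ * O₄ * O₃₄₅ + O₂ * O₅ * O₁₂₃ + O₃ * O₆ * O₂₃₄)
    + (O₁ * O₆ * O₆₁ + O₂ * O₁ * O₁₂ + O₃ * O₂ * O₂₃ + O₄ * O₃ * O₃₄ + O₅ * O₄ * O₄₅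
      + O₆ * O₅ * O₅₆)
    - (O₁ * O₃ * O₅ + O₂ * O₄ * O₆)
    - (O₁₂ ^ 2 + O₂₃ ^ 2 + O₃₄ ^ 2 + O₄₅ ^ 2 + O₅₆ ^ 2 + O₆₁ ^ 2) + 2 ^ 3

/-- The ideal of `P` generated by the 18 J-relators and the Casimir relator at `q = t = 1`. -/
def definingIdeal : Ideal P :=
  Ideal.span (Set.range relJ1 ∪ Set.range relJ2 ∪ Set.range relJ3 ∪ {relCasimir})

/-- The commutative algebra given by the 15 generators and the 19 relations at `q = t = 1`. -/
abbrev A : Type := P ⧸ definingIdeal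

/-! ### The 61 polynomials -/

/-- `g_{1}` at `q = t = 1`. -/
def g1 : P :=
  O₅₆ * O₆₁ - O₆ * O₂₃₄ - O₁ * O₅ + 2 * O₃

/-- `g_{2}` at `q = t = 1`. -/
def g2 : P :=
  O₁₂ * O₆₁ - O₁ * O₃₄₅ - O₂ * O₆ + 2 * O₄

/-- `g_{3}` at `q = t = 1`. -/
def g3 : P :=
  O₄₅ * O₅₆ - O₅ * O₁₂₃ - O₄ * O₆ + 2 * O₂

/-- `g_{4}` at `q = t = 1`. -/
def g4 : P :=
  O₃₄ * O₄₅ - O₄ * O₃₄₅ - O₃ * O₅ + 2 * O₁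

/-- `g_{5}` at `q = t = 1`. -/
def g5 : P :=
  O₂₃ * O₃₄ - O₃ * O₂₃₄ - O₂ * O₄ + 2 * O₆

/-- `g_{6}` at `q = t = 1`. -/
def g6 : P :=
  O₁₂ * O₂₃ - O₂ * O₁₂₃ - O₁ * O₃ + 2 * O₅

/-- `g_{7}` at `q = t = 1`. -/
def g7 : P :=
  O₃ * O₄ * O₅ - O₁ * O₂ * O₆ + O₆ * O₁₂ - O₅ * O₃₄ - O₃ * O₄₅ + O₂ * O₆₁

/-- `g_{8}` at `q = t = 1`. -/
def g8 : P :=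
  O₂ * O₃ * O₄ - O₁ * O₅ * O₆ - O₄ * O₂₃ - O₂ * O₃₄ + O₁ * O₅₆ + O₅ * O₆₁

/-- `g_{9}` at `q = t = 1`. -/
def g9 : P :=
  O₁ * O₂ * O₃ - O₄ * O₅ * O₆ - O₃ * O₁₂ - O₁ * O₂₃ + O₆ * O₄₅ + O₄ * O₅₆

/-- `g_{10}` at `q = t = 1`. -/
def g10 : P :=
  O₅₆ * O₃₄₅ - O₅ * O₁₂ - O₆ * O₃₄ + 2 * O₂ * O₃ - 2 * O₂₃

/-- `g_{11}` at `q = t = 1`. -/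
def g11 : P :=
  O₂₃ * O₃₄₅ - O₂ * O₄₅ - O₃ * O₆₁ + 2 * O₅ * O₆ - 2 * O₅₆

/-- `g_{12}` at `q = t = 1`. -/
def g12 : P :=
  O₄₅ * O₂₃₄ - O₅ * O₂₃ - O₄ * O₆₁ + 2 * O₁ * O₂ - 2 * O₁₂

/-- `g_{13}` at `q = t = 1`. -/
def g13 : P :=
  O₁₂ * O₂₃₄ - O₁ * O₃₄ - O₂ * O₅₆ + 2 * O₄ * O₅ - 2 * O₄₅

/-- `g_{14}` at `q = t = 1`. -/
def g14 : P :=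
  O₆₁ * O₁₂₃ - O₆ * O₂₃ - O₁ * O₄₅ + 2 * O₃ * O₄ - 2 * O₃₄

/-- `g_{15}` at `q = t = 1`. -/
def g15 : P :=
  O₃₄ * O₁₂₃ - O₄ * O₁₂ - O₃ * O₅₆ + 2 * O₁ * O₆ - 2 * O₆₁

/-- `g_{16}` at `q = t = 1`. -/
def g16 : P :=
  O₃ * O₄ * O₃₄ - O₁ * O₆ * O₆₁ - O₃₄ ^ 2 + O₆₁ ^ 2 + O₁ ^ 2 - O₃ ^ 2 - O₄ ^ 2 + O₆ ^ 2

/-- `g_{17}` at `q = t = 1`. -/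
def g17 : P :=
  O₂ * O₃ * O₂₃ - O₅ * O₆ * O₅₆ - O₂₃ ^ 2 + O₅₆ ^ 2 - O₂ ^ 2 - O₃ ^ 2 + O₅ ^ 2 + O₆ ^ 2

/-- `g_{18}` at `q = t = 1`. -/
def g18 : P :=
  O₁ * O₂ * O₁₂ - O₄ * O₅ * O₄₅ - O₁₂ ^ 2 + O₄₅ ^ 2 - O₁ ^ 2 - O₂ ^ 2 + O₄ ^ 2 + O₅ ^ 2

/-- `g_{19}` at `q = t = 1`. -/
def g19 : P :=
  O₂₃₄ * O₃₄₅ + 2 * O₄ * O₅ * O₆ - O₃₄ * O₆₁ - 2 * O₆ * O₄₅ - 2 * O₄ * O₅₆ - O₂ * O₅ + 2 * O₁₂₃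

/-- `g_{20}` at `q = t = 1`. -/
def g20 : P :=
  O₁₂₃ * O₃₄₅ + 2 * O₁ * O₅ * O₆ - O₁₂ * O₄₅ - 2 * O₁ * O₅₆ - 2 * O₅ * O₆₁ - O₃ * O₆ + 2 * O₂₃₄

/-- `g_{21}` at `q = t = 1`. -/
def g21 : P :=
  O₁₂₃ * O₂₃₄ + 2 * O₁ * O₂ * O₆ - O₂₃ * O₅₆ - 2 * O₆ * O₁₂ - 2 * O₂ * O₆₁ - O₁ * O₄ + 2 * O₃₄₅

/-- `g_{22}` at `q = t = 1`. -/
def g22 : P :=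
  O₄ * O₅ * O₆ ^ 2 - O₆ ^ 2 * O₄₅ - O₄ * O₆ * O₅₆ - O₂ * O₃ * O₆₁ + O₂₃ * O₆₁ + O₆ * O₁₂₃
    + O₃ * O₃₄₅ - O₄ * O₅

/-- `g_{23}` at `q = t = 1`. -/
def g23 : P :=
  O₁ * O₂ * O₆ ^ 2 - O₆ ^ 2 * O₁₂ - O₃ * O₄ * O₅₆ - O₂ * O₆ * O₆₁ + O₃₄ * O₅₆ + O₃ * O₁₂₃
    + O₆ * O₃₄₅ - O₁ * O₂

/-- `g_{24}` at `q = t = 1`. -/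
def g24 : P :=
  O₁ * O₅ ^ 2 * O₆ - O₂ * O₃ * O₄₅ - O₁ * O₅ * O₅₆ - O₅ ^ 2 * O₆₁ + O₂₃ * O₄₅ + O₅ * O₂₃₄
    + O₂ * O₃₄₅ - O₁ * O₆

/-- `g_{25}` at `q = t = 1`. -/
def g25 : P :=
  O₄ ^ 2 * O₅ * O₆ - O₁ * O₂ * O₃₄ - O₄ * O₆ * O₄₅ - O₄ ^ 2 * O₅₆ + O₁₂ * O₃₄ + O₄ * O₁₂₃
    + O₁ * O₂₃₄ - O₅ * O₆

/-- `g_{26}` at `q = t = 1`. -/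
def g26 : P :=
  O₁ * O₄ * O₅ * O₆ - O₁ * O₆ * O₄₅ - O₁ * O₄ * O₅₆ - O₄ * O₅ * O₆₁ + O₄₅ * O₆₁ + O₁ * O₁₂₃
    + O₄ * O₂₃₄ - O₂ * O₃

/-- `g_{27}` at `q = t = 1`. -/
def g27 : P :=
  O₁ * O₂ * O₅ * O₆ - O₅ * O₆ * O₁₂ - O₁ * O₂ * O₅₆ - O₂ * O₅ * O₆₁ + O₁₂ * O₅₆ + O₂ * O₂₃₄
    + O₅ * O₃₄₅ - O₃ * O₄

/-- `g_{28}` at `q = t = 1`. -/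
def g28 : P :=
  O₁ ^ 2 * O₅ * O₆ - O₃ * O₄ * O₁₂ - O₁ ^ 2 * O₅₆ - O₁ * O₅ * O₆₁ + O₁₂ * O₃₄ + O₄ * O₁₂₃
    + O₁ * O₂₃₄ - O₅ * O₆

/-- `g_{29}` at `q = t = 1`. -/
def g29 : P :=
  O₁ * O₂ ^ 2 * O₆ - O₂ * O₆ * O₁₂ - O₄ * O₅ * O₂₃ - O₂ ^ 2 * O₆₁ + O₂₃ * O₄₅ + O₅ * O₂₃₄
    + O₂ * O₃₄₅ - O₁ * O₆

/-- `g_{30}` at `q = t = 1`. -/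
def g30 : P :=
  O₁ * O₅ * O₆ * O₆₁ - O₅ * O₆₁ ^ 2 - O₁ * O₆ * O₂₃₄ - O₃ * O₄ * O₃₄₅ + O₆₁ * O₂₃₄ + O₃₄ * O₃₄₅
    - O₁ ^ 2 * O₅ - O₅ * O₆ ^ 2 + O₄ * O₄₅ + O₆ * O₅₆ + 2 * O₁ * O₃

/-- `g_{31}` at `q = t = 1`. -/
def g31 : P :=
  O₁ * O₂ * O₆ * O₆₁ - O₂ * O₆₁ ^ 2 - O₃ * O₄ * O₂₃₄ - O₁ * O₆ * O₃₄₅ + O₃₄ * O₂₃₄ + O₆₁ * O₃₄₅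
    - O₁ ^ 2 * O₂ - O₂ * O₆ ^ 2 + O₁ * O₁₂ + O₃ * O₂₃ + 2 * O₄ * O₆

/-- `g_{32}` at `q = t = 1`. -/
def g32 : P :=
  O₄ * O₅ * O₆ * O₅₆ - O₄ * O₅₆ ^ 2 - O₅ * O₆ * O₁₂₃ - O₂ * O₃ * O₂₃₄ + O₅₆ * O₁₂₃ + O₂₃ * O₂₃₄
    - O₄ * O₅ ^ 2 - O₄ * O₆ ^ 2 + O₃ * O₃₄ + O₅ * O₄₅ + 2 * O₂ * O₆

/-- `g_{33}` at `q = t = 1`. -/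
def g33 : P :=
  O₁ * O₅ * O₆ * O₅₆ - O₁ * O₅₆ ^ 2 - O₂ * O₃ * O₁₂₃ - O₅ * O₆ * O₂₃₄ + O₂₃ * O₁₂₃ + O₅₆ * O₂₃₄
    - O₁ * O₅ ^ 2 - O₁ * O₆ ^ 2 + O₂ * O₁₂ + O₆ * O₆₁ + 2 * O₃ * O₅

/-- `g_{34}` at `q = t = 1`. -/
def g34 : P :=
  O₄ * O₅ * O₆ * O₄₅ - O₆ * O₄₅ ^ 2 - O₄ * O₅ * O₁₂₃ - O₁ * O₂ * O₃₄₅ + O₄₅ * O₁₂₃ + O₁₂ * O₃₄₅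
    - O₄ ^ 2 * O₆ - O₅ ^ 2 * O₆ + O₅ * O₅₆ + O₁ * O₆₁ + 2 * O₂ * O₄

/-- `g_{35}` at `q = t = 1`. -/
def g35 : P :=
  O₁ * O₂ * O₆ * O₄₅ - O₆ * O₁₂ * O₄₅ - O₂ * O₄₅ * O₆₁ - O₁ * O₂ * O₁₂₃ + O₁₂ * O₁₂₃
    + O₄₅ * O₃₄₅ - O₃ * O₄ ^ 2 + O₂ * O₂₃ + O₄ * O₃₄

/-- `g_{36}` at `q = t = 1`. -/
def g36 : P :=
  O₅ * O₆ ^ 2 * O₃₄ - O₂ * O₃ ^ 2 * O₆₁ - O₆ * O₃₄ * O₅₆ + O₃ * O₂₃ * O₆₁ + O₃ ^ 2 * O₃₄₅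
    - O₆ ^ 2 * O₃₄₅ + O₆ * O₁₂ - O₅ * O₃₄ - O₃ * O₄₅ + O₂ * O₆₁

/-- `g_{37}` at `q = t = 1`. -/
def g37 : P :=
  O₁ * O₅ * O₆ * O₃₄ - O₁ * O₃₄ * O₅₆ - O₅ * O₃₄ * O₆₁ - O₁ * O₆ * O₃₄₅ + O₃₄ * O₂₃₄
    + O₆₁ * O₃₄₅ - O₂ * O₃ ^ 2 + O₁ * O₁₂ + O₃ * O₂₃

/-- `g_{38}` at `q = t = 1`. -/
def g38 : P :=
  O₁ * O₂ * O₆ * O₃₄ - O₆ * O₁₂ * O₃₄ - O₂ * O₃₄ * O₆₁ - O₁ * O₆ * O₂₃₄ + O₆₁ * O₂₃₄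
    + O₃₄ * O₃₄₅ - O₄ ^ 2 * O₅ + O₄ * O₄₅ + O₆ * O₅₆

/-- `g_{39}` at `q = t = 1`. -/
def g39 : P :=
  O₁ ^ 2 * O₂ * O₃₄ - O₄ ^ 2 * O₅ * O₆₁ - O₁ * O₁₂ * O₃₄ + O₄ * O₄₅ * O₆₁ - O₁ ^ 2 * O₂₃₄
    + O₄ ^ 2 * O₂₃₄ - O₄ * O₂₃ - O₂ * O₃₄ + O₁ * O₅₆ + O₅ * O₆₁

/-- `g_{40}` at `q = t = 1`. -/
def g40 : P :=
  O₁ * O₆ ^ 2 * O₂₃ - O₃ ^ 2 * O₄ * O₅₆ + O₃ * O₃₄ * O₅₆ - O₆ * O₂₃ * O₆₁ + O₃ ^ 2 * O₁₂₃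
    - O₆ ^ 2 * O₁₂₃ - O₃ * O₁₂ - O₁ * O₂₃ + O₆ * O₄₅ + O₄ * O₅₆

/-- `g_{41}` at `q = t = 1`. -/
def g41 : P :=
  O₄ * O₅ * O₆ * O₂₃ - O₆ * O₂₃ * O₄₅ - O₄ * O₂₃ * O₅₆ - O₅ * O₆ * O₂₃₄ + O₂₃ * O₁₂₃
    + O₅₆ * O₂₃₄ - O₁ * O₂ ^ 2 + O₂ * O₁₂ + O₆ * O₆₁

/-- `g_{42}` at `q = t = 1`. -/
def g42 : P :=
  O₁ * O₅ * O₆ * O₂₃ - O₁ * O₂₃ * O₅₆ - O₅ * O₂₃ * O₆₁ - O₅ * O₆ * O₁₂₃ + O₅₆ * O₁₂₃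
    + O₂₃ * O₂₃₄ - O₃ ^ 2 * O₄ + O₃ * O₃₄ + O₅ * O₄₅

/-- `g_{43}` at `q = t = 1`. -/
def g43 : P :=
  O₄ * O₅ ^ 2 * O₂₃ - O₁ * O₂ ^ 2 * O₅₆ - O₅ * O₂₃ * O₄₅ + O₂ * O₁₂ * O₅₆ + O₂ ^ 2 * O₂₃₄
    - O₅ ^ 2 * O₂₃₄ - O₄ * O₂₃ - O₂ * O₃₄ + O₁ * O₅₆ + O₅ * O₆₁

/-- `g_{44}` at `q = t = 1`. -/
def g44 : P :=
  O₅ ^ 2 * O₆ * O₁₂ - O₂ ^ 2 * O₃ * O₄₅ + O₂ * O₂₃ * O₄₅ - O₅ * O₁₂ * O₅₆ + O₂ ^ 2 * O₃₄₅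
    - O₅ ^ 2 * O₃₄₅ - O₆ * O₁₂ + O₅ * O₃₄ + O₃ * O₄₅ - O₂ * O₆₁

/-- `g_{45}` at `q = t = 1`. -/
def g45 : P :=
  O₄ * O₅ * O₆ * O₁₂ - O₆ * O₁₂ * O₄₅ - O₄ * O₁₂ * O₅₆ - O₄ * O₅ * O₃₄₅ + O₁₂ * O₁₂₃
    + O₄₅ * O₃₄₅ - O₂ ^ 2 * O₃ + O₂ * O₂₃ + O₄ * O₃₄

/-- `g_{46}` at `q = t = 1`. -/
def g46 : P :=
  O₃ * O₄ ^ 2 * O₁₂ - O₁ ^ 2 * O₆ * O₄₅ - O₄ * O₁₂ * O₃₄ + O₁ * O₄₅ * O₆₁ + O₁ ^ 2 * O₁₂₃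
    - O₄ ^ 2 * O₁₂₃ - O₃ * O₁₂ - O₁ * O₂₃ + O₆ * O₄₅ + O₄ * O₅₆

/-- `g_{47}` at `q = t = 1`. -/
def g47 : P :=
  O₁ * O₂ * O₆ * O₃₄₅ - O₆ * O₁₂ * O₃₄₅ - O₂ * O₆₁ * O₃₄₅ + O₃₄₅ ^ 2 - O₄ * O₅ * O₄₅
    - O₁ * O₆ * O₆₁ + O₄₅ ^ 2 + O₆₁ ^ 2 + O₅ ^ 2 + O₆ ^ 2 - 4

/-- `g_{48}` at `q = t = 1`. -/
def g48 : P :=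
  O₁ * O₅ * O₆ * O₂₃₄ - O₁ * O₅₆ * O₂₃₄ - O₅ * O₆₁ * O₂₃₄ + O₂₃₄ ^ 2 - O₅ * O₆ * O₅₆
    - O₁ * O₆ * O₆₁ + O₅₆ ^ 2 + O₆₁ ^ 2 + O₁ ^ 2 - O₃ ^ 2 + O₅ ^ 2 + O₆ ^ 2 - 4

/-- `g_{49}` at `q = t = 1`. -/
def g49 : P :=
  O₄ * O₅ * O₆ * O₁₂₃ - O₆ * O₄₅ * O₁₂₃ - O₄ * O₅₆ * O₁₂₃ + O₁₂₃ ^ 2 - O₄ * O₅ * O₄₅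
    - O₅ * O₆ * O₅₆ + O₄₅ ^ 2 + O₅₆ ^ 2 - O₂ ^ 2 + O₄ ^ 2 + O₅ ^ 2 + O₆ ^ 2 - 4

/-- `g_{50}` at `q = t = 1`. -/
def g50 : P :=
  O₁ * O₆ * O₄₅ * O₆₁ - O₃ * O₄ ^ 2 * O₃₄₅ - O₄₅ * O₆₁ ^ 2 + O₄ * O₃₄ * O₃₄₅ - O₁ * O₆ * O₂₃
    - O₁ ^ 2 * O₄₅ + O₄ ^ 2 * O₄₅ - O₆ ^ 2 * O₄₅ + 2 * O₁ * O₃ * O₄ + O₂₃ * O₆₁ + O₆ * O₁₂₃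
    + O₃ * O₃₄₅ - 2 * O₁ * O₃₄ - O₄ * O₅

/-- `g_{51}` at `q = t = 1`. -/
def g51 : P :=
  O₄ * O₅ * O₄₅ * O₆₁ - O₁ ^ 2 * O₂ * O₃₄₅ - O₄₅ ^ 2 * O₆₁ + O₁ * O₁₂ * O₃₄₅ - O₄ * O₅ * O₂₃
    + O₁ ^ 2 * O₆₁ - O₄ ^ 2 * O₆₁ - O₅ ^ 2 * O₆₁ + 2 * O₁ * O₂ * O₄ + O₂₃ * O₄₅ + O₅ * O₂₃₄
    + O₂ * O₃₄₅ - 2 * O₄ * O₁₂ - O₁ * O₆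

/-- `g_{52}` at `q = t = 1`. -/
def g52 : P :=
  O₂ * O₃ * O₄₅ * O₆₁ - O₂₃ * O₄₅ * O₆₁ - O₃ * O₄₅ * O₃₄₅ - O₂ * O₆₁ * O₃₄₅ - O₅ ^ 2 * O₆ ^ 2
    + O₃₄₅ ^ 2 + O₅ * O₆ * O₅₆ + O₄₅ ^ 2 + O₆₁ ^ 2 + O₅ ^ 2 + O₆ ^ 2 - 4

/-- `g_{53}` at `q = t = 1`. -/
def g53 : P :=
  O₁ * O₆ * O₂₃ * O₆₁ - O₃ ^ 2 * O₄ * O₂₃₄ - O₂₃ * O₆₁ ^ 2 + O₃ * O₃₄ * O₂₃₄ - O₁ ^ 2 * O₂₃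
    + O₃ ^ 2 * O₂₃ - O₆ ^ 2 * O₂₃ - O₁ * O₆ * O₄₅ + 2 * O₃ * O₄ * O₆ + O₄₅ * O₆₁ + O₁ * O₁₂₃
    + O₄ * O₂₃₄ - 2 * O₆ * O₃₄ - O₂ * O₃

/-- `g_{54}` at `q = t = 1`. -/
def g54 : P :=
  O₄ * O₅ * O₂₃ * O₆₁ - O₂₃ * O₄₅ * O₆₁ - O₄ * O₂₃ * O₂₃₄ - O₅ * O₆₁ * O₂₃₄ - O₁ ^ 2 * O₂ ^ 2
    + O₂₃₄ ^ 2 + O₄ * O₅ * O₄₅ + O₁₂ ^ 2 + O₂₃ ^ 2 - O₄₅ ^ 2 + O₆₁ ^ 2 + 2 * O₁ ^ 2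
    + 2 * O₂ ^ 2 - O₄ ^ 2 - O₅ ^ 2 - 4

/-- `g_{55}` at `q = t = 1`. -/
def g55 : P :=
  O₅ * O₆ * O₃₄ * O₅₆ - O₂ * O₃ ^ 2 * O₂₃₄ - O₃₄ * O₅₆ ^ 2 + O₃ * O₂₃ * O₂₃₄ - O₅ * O₆ * O₁₂
    + O₃ ^ 2 * O₃₄ - O₅ ^ 2 * O₃₄ - O₆ ^ 2 * O₃₄ + 2 * O₂ * O₃ * O₆ + O₁₂ * O₅₆ + O₂ * O₂₃₄
    + O₅ * O₃₄₅ - 2 * O₆ * O₂₃ - O₃ * O₄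

/-- `g_{56}` at `q = t = 1`. -/
def g56 : P :=
  O₁ * O₂ * O₃₄ * O₅₆ - O₁₂ * O₃₄ * O₅₆ - O₂ * O₃₄ * O₂₃₄ - O₁ * O₅₆ * O₂₃₄ - O₄ ^ 2 * O₅ ^ 2
    + O₂₃₄ ^ 2 + O₄ * O₅ * O₄₅ + O₃₄ ^ 2 + O₅₆ ^ 2 + O₄ ^ 2 + O₅ ^ 2 - 4

/-- `g_{57}` at `q = t = 1`. -/
def g57 : P :=
  O₅ * O₆ * O₁₂ * O₅₆ - O₂ ^ 2 * O₃ * O₁₂₃ - O₁₂ * O₅₆ ^ 2 + O₂ * O₂₃ * O₁₂₃ + O₂ ^ 2 * O₁₂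
    - O₅ ^ 2 * O₁₂ - O₆ ^ 2 * O₁₂ - O₅ * O₆ * O₃₄ + 2 * O₂ * O₃ * O₅ + O₃₄ * O₅₆ + O₃ * O₁₂₃
    + O₆ * O₃₄₅ - 2 * O₅ * O₂₃ - O₁ * O₂

/-- `g_{58}` at `q = t = 1`. -/
def g58 : P :=
  O₃ * O₄ * O₁₂ * O₅₆ - O₁₂ * O₃₄ * O₅₆ - O₃ * O₁₂ * O₁₂₃ - O₄ * O₅₆ * O₁₂₃ - O₁ ^ 2 * O₆ ^ 2
    + O₁₂₃ ^ 2 + O₁ * O₆ * O₆₁ + O₁₂ ^ 2 + O₅₆ ^ 2 + O₁ ^ 2 + O₆ ^ 2 - 4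

/-- `g_{59}` at `q = t = 1`. -/
def g59 : P :=
  O₁ * O₆ * O₂₃ * O₄₅ - O₂₃ * O₄₅ * O₆₁ - O₁ * O₂₃ * O₁₂₃ - O₆ * O₄₅ * O₁₂₃ - O₃ ^ 2 * O₄ ^ 2
    + O₁₂₃ ^ 2 + O₁ * O₆ * O₆₁ + O₂₃ ^ 2 + O₃₄ ^ 2 + O₄₅ ^ 2 - O₆₁ ^ 2 - O₁ ^ 2 + 2 * O₃ ^ 2
    + 2 * O₄ ^ 2 - O₆ ^ 2 - 4

/-- `g_{60}` at `q = t = 1`. -/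
def g60 : P :=
  O₄ * O₅ * O₂₃ * O₄₅ - O₁ * O₂ ^ 2 * O₁₂₃ - O₂₃ * O₄₅ ^ 2 + O₂ * O₁₂ * O₁₂₃ + O₂ ^ 2 * O₂₃
    - O₄ ^ 2 * O₂₃ - O₅ ^ 2 * O₂₃ - O₄ * O₅ * O₆₁ + 2 * O₁ * O₂ * O₅ + O₄₅ * O₆₁ + O₁ * O₁₂₃
    + O₄ * O₂₃₄ - 2 * O₅ * O₁₂ - O₂ * O₃

/-- `g_{61}` at `q = t = 1`. -/
def g61 : P :=
  O₅ * O₆ * O₁₂ * O₃₄ - O₁₂ * O₃₄ * O₅₆ - O₆ * O₁₂ * O₃₄₅ - O₅ * O₃₄ * O₃₄₅ - O₂ ^ 2 * O₃ ^ 2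
    + O₃₄₅ ^ 2 + O₅ * O₆ * O₅₆ + O₁₂ ^ 2 + O₂₃ ^ 2 + O₃₄ ^ 2 - O₅₆ ^ 2 + 2 * O₂ ^ 2
    + 2 * O₃ ^ 2 - O₅ ^ 2 - O₆ ^ 2 - 4

/-- The family of the 61 polynomials; `g i` is `g_{i+1}`. -/
def g : Fin 61 → P :=
  ![g1, g2, g3, g4, g5, g6, g7, g8, g9, g10, g11, g12, g13, g14, g15, g16, g17, g18, g19, g20,
    g21, g22, g23, g24, g25, g26, g27, g28, g29, g30, g31, g32, g33, g34, g35, g36, g37, g38,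
    g39, g40, g41, g42, g43, g44, g45, g46, g47, g48, g49, g50, g51, g52, g53, g54, g55, g56,
    g57, g58, g59, g60, g61]

end

end GenusTwo

/-!
The 61 polynomials and the 19 relators generate the same ideal: either family consists of explicit
combinations of the other one (`definingIdeal_le_span`, `g_mem`). That the leading terms of the 61
polynomials generate all leading terms of the ideal is Buchberger's criterion
(`exists_degree_le_of_mem_span`), proved here in a form that asks for few S-polynomials: for
`j < i` there has to be some `k < i` such that the leading monomial of `g k` divides the least
common multiple of those of `g i` and `g j` and the S-polynomial of `g i` and `g k` is a sum of
multiples of members of `g` with leading monomials below the least common multiple of the pair.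

For pairs with coprime leading monomials this is `sPoly_mem_lowerSpan_of_disjoint`. The remaining
S-polynomials are divided by the family, and the divisions are carried out in the kernel
(`pairsReduce_lt`). To make this fast, a monomial is represented by one natural number, its code,
by the Kronecker substitution that sends a variable `X v` of weight `w` to the power `w * 32 ^ 15 -
32 ^ v` of a single variable. Products of monomials become sums of codes, and as long as all
exponents are below `32` the codes determine the monomials and are ordered like them
(`code_lt_code`, `eq_of_kron_eq`). The bound on the exponents follows from the bound on the
weighted degrees that the division respects. The soundness of the computation is
`exists_mem_lowerSpan_of_reducesToZero`: it produces a member of the span in question that has the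
same image as the S-polynomial under the substitution, hence equals it.
-/

/-! ### Buchberger's criterion -/

section Buchberger

open scoped MonomialOrder

variable {σ K ι : Type*} [Field K] (m : MonomialOrder σ)

/-- The `K`-span of the monomial multiples `x ^ a * g i` whose leading exponent `a + deg (g i)` lies
below `M`. A polynomial in this span has a representation by the family `g` in which all
products have leading monomial smaller than `M`. -/
noncomputable def lowerSpan (g : ι → MvPolynomial σ K) (M : σ →₀ ℕ) :
    Submodule K (MvPolynomial σ K) :=
  Submodule.span K {p | ∃ i a, a + m.degree (g i) ≺[m] M ∧ p = monomial a 1 * g i}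

variable {m} {g : ι → MvPolynomial σ K} {M N : σ →₀ ℕ}

theorem monomial_mul_mem_lowerSpan {i : ι} {a : σ →₀ ℕ} (h : a + m.degree (g i) ≺[m] M) (c : K) :
    monomial a c * g i ∈ lowerSpan m g M := by
  have : monomial a c * g i = c • (monomial a 1 * g i) := by
    rw [← smul_mul_assoc, smul_monomial, smul_eq_mul, mul_one]
  rw [this]
  exact Submodule.smul_mem _ _ (Submodule.subset_span ⟨i, a, h, rfl⟩)

theorem monomial_mul_mem_lowerSpan_add {f : MvPolynomial σ K} (hf : f ∈ lowerSpan m g M)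
    (a : σ →₀ ℕ) : monomial a 1 * f ∈ lowerSpan m g (a + M) := by
  unfold lowerSpan at hf
  induction hf using Submodule.span_induction with
  | mem p hp =>
    obtain ⟨i, b, hb, rfl⟩ := hp
    rw [← mul_assoc, monomial_mul, mul_one]
    refine monomial_mul_mem_lowerSpan ?_ 1
    rw [add_assoc, map_add, map_add _ a M]
    exact add_lt_add_right hb _
  | zero => simp
  | add p q _ _ hp hq => rw [mul_add]; exact Submodule.add_mem _ hp hq
  | smul c p _ hp => rw [mul_smul_comm]; exact Submodule.smul_mem _ _ hp

theorem mul_mem_lowerSpan {i : ι} {p : MvPolynomial σ K}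
    (hp : ∀ a ∈ p.support, a + m.degree (g i) ≺[m] M) : p * g i ∈ lowerSpan m g M := by
  rw [p.as_sum, Finset.sum_mul]
  exact Submodule.sum_mem _ fun a ha => monomial_mul_mem_lowerSpan (hp a ha) _

theorem lt_of_mem_support_of_mem_lowerSpan {f : MvPolynomial σ K} (hf : f ∈ lowerSpan m g M) :
    ∀ e ∈ f.support, e ≺[m] M := by
  classical
  unfold lowerSpan at hf
  induction hf using Submodule.span_induction with
  | mem p hp =>
    obtain ⟨i, a, ha, rfl⟩ := hp
    intro e he
    refine lt_of_le_of_lt (m.le_degree he) (lt_of_le_of_lt (m.degree_mul_le) (lt_of_le_of_lt ?_ ha))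
    rw [map_add, map_add]
    exact add_le_add_left (m.degree_monomial_le 1) _
  | zero => simp
  | add p q _ _ hp hq =>
    intro e he
    rcases Finset.mem_union.1 (support_add he) with h | h
    exacts [hp e h, hq e h]
  | smul c p _ hp => exact fun e he => hp e (support_smul he)

/-- An element of `lowerSpan m g M` involves finitely many products, so it is `0` or one of their
leading monomials `N` bounds all of them. -/
theorem exists_of_mem_lowerSpan {f : MvPolynomial σ K} (hf : f ∈ lowerSpan m g M) :
    f = 0 ∨ ∃ N, N ≺[m] M ∧
      f ∈ Submodule.span K {p | ∃ i a, a + m.degree (g i) ≼[m] N ∧ p = monomial a 1 * g i} := by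
  unfold lowerSpan at hf
  induction hf using Submodule.span_induction with
  | mem p hp =>
    obtain ⟨i, a, ha, rfl⟩ := hp
    exact Or.inr ⟨_, ha, Submodule.subset_span ⟨i, a, le_rfl, rfl⟩⟩
  | zero => exact Or.inl rfl
  | add p q _ _ hp hq =>
    rcases hp with rfl | ⟨N, hN, hp⟩
    · rwa [zero_add]
    rcases hq with rfl | ⟨N', hN', hq⟩
    · rw [add_zero]
      exact Or.inr ⟨N, hN, hp⟩
    right
    rcases le_total (m.toSyn N) (m.toSyn N') with h | h
    · refine ⟨N', hN', Submodule.add_mem _ (Submodule.span_mono ?_ hp) hq⟩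
      rintro _ ⟨i, a, ha, rfl⟩
      exact ⟨i, a, ha.trans h, rfl⟩
    · refine ⟨N, hN, Submodule.add_mem _ hp (Submodule.span_mono ?_ hq)⟩
      rintro _ ⟨i, a, ha, rfl⟩
      exact ⟨i, a, ha.trans h, rfl⟩
  | smul c p _ hp =>
    rcases hp with rfl | ⟨N, hN, hp⟩
    · simp
    · exact Or.inr ⟨N, hN, Submodule.smul_mem _ _ hp⟩

variable (m g) in
/-- The S-polynomial of `g i` and `g j`, for monic `g i` and `g j`. -/
noncomputable def sPoly (i j : ι) : MvPolynomial σ K :=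
  monomial ((m.degree (g i) ⊔ m.degree (g j)) - m.degree (g i)) 1 * g i
    - monomial ((m.degree (g i) ⊔ m.degree (g j)) - m.degree (g j)) 1 * g j

/-- Any two multiples of members of `g` with the same leading monomial `M` agree up to products
with smaller leading monomials. For `j < i` this compares `g i` with a member `g k`, `k < i`, such
that the least common multiple of the leading monomials of `g i` and `g k` divides `M`, and then
`g k` with `g j`, a pair of smaller indices. -/
theorem monomial_mul_sub_monomial_mul_mem_lowerSpan [LinearOrder ι] [WellFoundedLT ι]
    (hS : ∀ i j, j < i → ∃ k < i, m.degree (g k) ≤ m.degree (g i) ⊔ m.degree (g j) ∧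
      sPoly m g i k ∈ lowerSpan m g (m.degree (g i) ⊔ m.degree (g k)))
    (M : σ →₀ ℕ) (i j : ι) (hi : m.degree (g i) ≤ M) (hj : m.degree (g j) ≤ M) :
    monomial (M - m.degree (g i)) 1 * g i - monomial (M - m.degree (g j)) 1 * g j
      ∈ lowerSpan m g M := by
  obtain ⟨n, hin, hjn⟩ : ∃ n, i ≤ n ∧ j ≤ n := ⟨max i j, le_max_left _ _, le_max_right _ _⟩
  induction n using WellFoundedLT.induction generalizing i j with
  | ind n ih =>
  have key : ∀ i j, m.degree (g i) ≤ M → m.degree (g j) ≤ M → i ≤ n → j < i →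
      monomial (M - m.degree (g i)) 1 * g i - monomial (M - m.degree (g j)) 1 * g j
        ∈ lowerSpan m g M := by
    intro i j hi hj hin hji
    obtain ⟨k, hki, hk, hS⟩ := hS i j hji
    have hkM := hk.trans (sup_le hi hj)
    have hL : m.degree (g i) ⊔ m.degree (g k) ≤ M := sup_le hi hkM
    have h1 := monomial_mul_mem_lowerSpan_add hS (M - (m.degree (g i) ⊔ m.degree (g k)))
    rw [tsub_add_cancel_of_le hL, sPoly, mul_sub, ← mul_assoc, ← mul_assoc, monomial_mul,
      monomial_mul, mul_one, tsub_add_tsub_cancel hL le_sup_left,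
      tsub_add_tsub_cancel hL le_sup_right] at h1
    have h2 := ih (max k j) ((max_lt hki hji).trans_le hin) k j hkM hj
      (le_max_left _ _) (le_max_right _ _)
    simpa using Submodule.add_mem _ h1 h2
  rcases lt_trichotomy j i with h | rfl | h
  · exact key i j hi hj hin h
  · simp
  · rw [← neg_sub]
    exact Submodule.neg_mem _ (key j i hj hi hjn h)

/-- Buchberger's criterion. A representation of `f` by the family `g` in which the largest leading
monomial `M` of a product is as small as possible does not cancel at `M`, as otherwise the
products at `M` could be traded for smaller ones. -/
theorem exists_degree_le_of_mem_span [LinearOrder ι] [Fintype ι] (hg : ∀ i, m.Monic (g i))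
    (hS : ∀ i j, j < i → ∃ k < i, m.degree (g k) ≤ m.degree (g i) ⊔ m.degree (g j) ∧
      sPoly m g i k ∈ lowerSpan m g (m.degree (g i) ⊔ m.degree (g k)))
    {f : MvPolynomial σ K} (hf : f ∈ Ideal.span (Set.range g)) (hf0 : f ≠ 0) :
    ∃ i, m.degree (g i) ≤ m.degree f := by
  classical
  -- `leSpan N` is the span of the products with leading monomial at most `N`.
  let leSpan (N : σ →₀ ℕ) : Submodule K (MvPolynomial σ K) :=
    Submodule.span K {p | ∃ i a, a + m.degree (g i) ≼[m] N ∧ p = monomial a 1 * g i}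
  have main : ∀ s : m.syn, ∀ N, m.toSyn N = s → f ∈ leSpan N →
      ∃ i, m.degree (g i) ≤ m.degree f := by
    intro s
    induction s using WellFoundedLT.induction with
    | ind s ih =>
    rintro N rfl hN
    have of_lower : f ∈ lowerSpan m g N → ∃ i, m.degree (g i) ≤ m.degree f := by
      intro h
      rcases exists_of_mem_lowerSpan h with h | ⟨N', hN', h⟩
      · exact absurd h hf0
      · exact ih _ hN' N' rfl h
    by_cases hex : ∃ i, m.degree (g i) ≤ N
    · obtain ⟨i, hi⟩ := hex
      have hle : leSpan N ≤ Submodule.span K {monomial (N - m.degree (g i)) 1 * g i}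
          ⊔ lowerSpan m g N := by
        refine Submodule.span_le.2 ?_
        rintro _ ⟨j, a, ha, rfl⟩
        rcases ha.lt_or_eq with ha | ha
        · exact Submodule.mem_sup_right (monomial_mul_mem_lowerSpan ha 1)
        · have ha := m.toSyn.injective ha
          have hj : m.degree (g j) ≤ N := ha ▸ le_add_self
          have hd := monomial_mul_sub_monomial_mul_mem_lowerSpan hS N j i hj hi
          rw [← ha, add_tsub_cancel_right, ha] at hd
          exact Submodule.mem_sup.2 ⟨_, Submodule.mem_span_singleton_self _, _, hd, by ring⟩
      obtain ⟨_, h1, v, hv, rfl⟩ := Submodule.mem_sup.1 (hle hN)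
      obtain ⟨c, rfl⟩ := Submodule.mem_span_singleton.1 h1
      by_cases hc : c = 0
      · subst hc
        exact of_lower (by simpa using hv)
      -- The coefficient `c` at `N` survives, so `N` is the leading exponent.
      have hvlt := lt_of_mem_support_of_mem_lowerSpan hv
      refine ⟨i, ?_⟩
      have hcoeff : coeff N (c • (monomial (N - m.degree (g i)) 1 * g i) + v) = c := by
        have h1 : coeff N v = 0 := by
          by_contra h
          exact lt_irrefl _ (hvlt N (mem_support_iff.2 h))
        have h2 : coeff N (monomial (N - m.degree (g i)) 1 * g i) = 1 := by
          rw [coeff_monomial_mul', if_pos tsub_le_self, tsub_tsub_cancel_of_le hi, one_mul,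
            (hg i).coeff_degree]
        rw [coeff_add, coeff_smul, h1, h2, smul_eq_mul, mul_one, add_zero]
      have hmem : N ∈ (c • (monomial (N - m.degree (g i)) 1 * g i) + v).support :=
        mem_support_iff.2 (hcoeff.trans_ne hc)
      have hdeg : m.degree (c • (monomial (N - m.degree (g i)) 1 * g i) + v) = N := by
        refine m.toSyn.injective (le_antisymm ?_ (m.le_degree hmem))
        refine (m.degree_add_le).trans (sup_le ?_ ?_)
        · refine (m.degree_smul_le).trans ((m.degree_mul_le).trans ?_)
          rw [m.degree_monomial, if_neg one_ne_zero, tsub_add_cancel_of_le hi]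
        · exact m.degree_le_iff.2 fun e he => (hvlt e he).le
      rwa [hdeg]
    · refine of_lower (Submodule.span_mono ?_ hN)
      rintro _ ⟨j, a, ha, rfl⟩
      refine ⟨j, a, lt_of_le_of_ne ha fun h => hex ⟨j, ?_⟩, rfl⟩
      rw [← m.toSyn.injective h]
      exact le_add_self
  obtain ⟨c, hc⟩ := Ideal.mem_span_range_iff_exists_fun.1 hf
  obtain ⟨s, hs⟩ := ((Finset.univ : Finset ι).biUnion fun i =>
    (c i).support.image fun a => m.toSyn (a + m.degree (g i))).exists_le
  refine main s (m.toSyn.symm s) (by simp) ?_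
  rw [← hc]
  refine Submodule.sum_mem _ fun i _ => ?_
  rw [(c i).as_sum, Finset.sum_mul]
  refine Submodule.sum_mem _ fun a ha => ?_
  have : monomial a (coeff a (c i)) * g i = coeff a (c i) • (monomial a 1 * g i) := by
    rw [← smul_mul_assoc, smul_monomial, smul_eq_mul, mul_one]
  rw [this]
  refine Submodule.smul_mem _ _ (Submodule.subset_span ⟨i, a, ?_, rfl⟩)
  simpa using hs _ (Finset.mem_biUnion.2 ⟨i, Finset.mem_univ _, Finset.mem_image_of_mem _ ha⟩)

theorem degree_sPoly_le (i j : ι) :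
    m.degree (sPoly m g i j) ≼[m] m.degree (g i) ⊔ m.degree (g j) := by
  classical
  refine m.degree_le_iff.2 fun e he => ?_
  rcases Finset.mem_union.1 (support_sub σ _ _ he) with h | h
  · refine (m.le_degree h).trans (m.degree_mul_le.trans ?_)
    rw [m.degree_monomial, if_neg one_ne_zero, tsub_add_cancel_of_le le_sup_left]
  · refine (m.le_degree h).trans (m.degree_mul_le.trans ?_)
    rw [m.degree_monomial, if_neg one_ne_zero, tsub_add_cancel_of_le le_sup_right]

theorem degree_monomial_add_of_lt {d : σ →₀ ℕ} {t : MvPolynomial σ K}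
    (ht : ∀ e ∈ t.support, e ≺[m] d) : m.degree (monomial d 1 + t) = d := by
  classical
  by_cases h : t = 0
  · rw [h, add_zero, m.degree_monomial, if_neg one_ne_zero]
  · have hd : m.degree (monomial d (1 : K)) = d := by rw [m.degree_monomial, if_neg one_ne_zero]
    rw [m.degree_add_of_lt, hd]
    rw [hd]
    exact ht _ (m.degree_mem_support h)

theorem monic_monomial_add_of_lt {d : σ →₀ ℕ} {t : MvPolynomial σ K}
    (ht : ∀ e ∈ t.support, e ≺[m] d) : m.Monic (monomial d 1 + t) := by
  classical
  rw [MonomialOrder.Monic, MonomialOrder.leadingCoeff, degree_monomial_add_of_lt ht, coeff_add,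
    coeff_monomial, if_pos rfl, notMem_support_iff.1 fun h => lt_irrefl _ (ht d h), add_zero]

/-- Buchberger's product criterion. If the leading monomials of `g i` and `g j` are coprime, then
the S-polynomial is `tᵢ * g j - tⱼ * g i`, where `tᵢ` and `tⱼ` are `g i` and `g j` without their
leading terms. -/
theorem sPoly_mem_lowerSpan_of_disjoint {i j : ι} {t : ι → MvPolynomial σ K}
    (ht : ∀ i, g i = monomial (m.degree (g i)) 1 + t i)
    (htlt : ∀ i, ∀ e ∈ (t i).support, e ≺[m] m.degree (g i))
    (h : m.degree (g i) ⊔ m.degree (g j) = m.degree (g i) + m.degree (g j)) :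
    sPoly m g i j ∈ lowerSpan m g (m.degree (g i) ⊔ m.degree (g j)) := by
  have hs : sPoly m g i j = t i * g j - t j * g i := by
    rw [sPoly, h, add_tsub_cancel_left, add_tsub_cancel_right]
    linear_combination g j * ht i - g i * ht j
  rw [hs, h]
  refine Submodule.sub_mem _ (mul_mem_lowerSpan fun a ha => ?_) (mul_mem_lowerSpan fun a ha => ?_)
  · rw [map_add, map_add]
    exact add_lt_add_left (htlt i a ha) _
  · rw [add_comm (m.degree (g i)), map_add, map_add]
    exact add_lt_add_left (htlt j a ha) _

end Buchberger

namespace GenusTwo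

/-! ### Kronecker substitution -/

open scoped MonomialOrder

/-- The codes of the variables. The term `32 ^ v` enters with a minus sign as a larger exponent of
the last variable makes a monomial smaller in the reverse lexicographic order. -/
def varCodes : List ℕ :=
  [2 * 32 ^ 15 - 32 ^ 0, 2 * 32 ^ 15 - 32 ^ 1, 2 * 32 ^ 15 - 32 ^ 2, 2 * 32 ^ 15 - 32 ^ 3,
    2 * 32 ^ 15 - 32 ^ 4, 2 * 32 ^ 15 - 32 ^ 5, 3 * 32 ^ 15 - 32 ^ 6, 3 * 32 ^ 15 - 32 ^ 7,
    3 * 32 ^ 15 - 32 ^ 8, 3 * 32 ^ 15 - 32 ^ 9, 3 * 32 ^ 15 - 32 ^ 10, 3 * 32 ^ 15 - 32 ^ 11,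
    4 * 32 ^ 15 - 32 ^ 12, 4 * 32 ^ 15 - 32 ^ 13, 4 * 32 ^ 15 - 32 ^ 14]

/-- The code of the variable `X v`, and `0` out of range. -/
def varCode (v : ℕ) : ℕ := varCodes.getD v 0

/-- The code of an exponent vector: its weighted degree times `32 ^ 15`, minus the number whose
digits in base `32` are the exponents. For exponents below `32`, codes compare like monomials. -/
noncomputable def code : (Fin 15 →₀ ℕ) →+ ℕ := Finsupp.weight fun i : Fin 15 => varCode i

/-- The number whose digits in base `32` are the exponents. -/
def packed (e : Fin 15 →₀ ℕ) : ℕ := ∑ i : Fin 15, e i * 32 ^ (i : ℕ)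

theorem code_add_packed (e : Fin 15 →₀ ℕ) :
    code e + packed e = Finsupp.weight weights e * 32 ^ 15 := by
  have h : ∀ i : Fin 15, varCode i + 32 ^ (i : ℕ) = weights i * 32 ^ 15 := by decide
  rw [code, Finsupp.weight_apply, Finsupp.weight_apply, Finsupp.sum_fintype _ _ (by simp),
    Finsupp.sum_fintype _ _ (by simp), packed, ← Finset.sum_add_distrib, Finset.sum_mul]
  refine Finset.sum_congr rfl fun i _ => ?_
  rw [smul_eq_mul, smul_eq_mul, mul_assoc, ← h i, mul_add]

theorem sum_mul_pow_lt {n : ℕ} {a : Fin n → ℕ} (ha : ∀ i, a i < 32) :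
    ∑ i : Fin n, a i * 32 ^ (i : ℕ) < 32 ^ n := by
  induction n with
  | zero => simp
  | succ n ih =>
    rw [Fin.sum_univ_castSucc]
    have h1 := ih fun i => ha i.castSucc
    have h2 := Nat.mul_le_mul_right (32 ^ n) (Nat.le_of_lt_succ (ha (Fin.last n)))
    simp only [Fin.val_castSucc, Fin.val_last]
    rw [pow_succ]
    omega

theorem sum_mul_pow_lt_sum_mul_pow {n : ℕ} {a b : Fin n → ℕ} (ha : ∀ i, a i < 32) {i : Fin n}
    (hj : ∀ j, i < j → a j = b j) (hi : a i < b i) :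
    ∑ i : Fin n, a i * 32 ^ (i : ℕ) < ∑ i : Fin n, b i * 32 ^ (i : ℕ) := by
  induction n with
  | zero => exact i.elim0
  | succ n ih =>
    rw [Fin.sum_univ_castSucc, Fin.sum_univ_castSucc]
    induction i using Fin.lastCases with
    | last =>
      have h1 := sum_mul_pow_lt fun i : Fin n => ha i.castSucc
      have h2 := Nat.mul_le_mul_right (32 ^ n) (Nat.succ_le_of_lt hi)
      simp only [Fin.val_castSucc, Fin.val_last]
      rw [Nat.succ_mul] at h2
      omega
    | cast i =>
      have h1 := ih (a := fun i => a i.castSucc) (b := fun i => b i.castSucc)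
        (fun i => ha i.castSucc) (fun j hij => hj j.castSucc (Fin.castSucc_lt_castSucc_iff.2 hij))
        hi
      rw [hj (Fin.last n) (Fin.castSucc_lt_last i)]
      simpa using h1

theorem code_lt_code {a b : Fin 15 →₀ ℕ} (hb : ∀ i, b i < 32)
    (h : a ≺[order] b) : code a < code b := by
  have h1 := code_add_packed a
  have h2 := code_add_packed b
  have h3 : packed b < 32 ^ 15 := sum_mul_pow_lt hb
  rcases (wDegRevLex_lt_iff weights weights_pos a b).1 h with h | ⟨h, i, hj, hi⟩
  · have := Nat.mul_le_mul_right (32 ^ 15) (Nat.succ_le_of_lt h)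
    rw [Nat.succ_mul] at this
    omega
  · have : packed b < packed a := sum_mul_pow_lt_sum_mul_pow hb (fun j hij => (hj j hij).symm) hi
    rw [h] at h1
    omega

theorem lt_of_code_lt_code {a b : Fin 15 →₀ ℕ} (ha : ∀ i, a i < 32)
    (h : code a < code b) : a ≺[order] b := by
  rcases lt_trichotomy (order.toSyn a) (order.toSyn b) with h' | h' | h'
  · exact h'
  · rw [order.toSyn.injective h'] at h
    exact absurd h (lt_irrefl _)
  · exact absurd (code_lt_code ha h') h.not_gt

theorem code_injOn {a b : Fin 15 →₀ ℕ} (ha : ∀ i, a i < 32) (hb : ∀ i, b i < 32)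
    (h : code a = code b) : a = b := by
  by_contra hab
  rcases lt_or_gt_of_ne (order.toSyn.injective.ne hab) with h' | h'
  · have := code_lt_code hb h'
    rw [h] at this
    exact lt_irrefl _ this
  · have := code_lt_code ha h'
    rw [h] at this
    exact lt_irrefl _ this

/-- Kronecker substitution: the monomial `x ^ e` goes to the power `code e` of one variable. -/
noncomputable def kron : P →ₐ[ℂ] Polynomial ℂ := aeval fun i : Fin 15 => Polynomial.X ^ varCode i

theorem aeval_X_pow_monomial {σ R : Type*} [Fintype σ] [CommSemiring R] (w : σ → ℕ) (e : σ →₀ ℕ)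
    (c : R) : aeval (fun i => (Polynomial.X : Polynomial R) ^ w i) (monomial e c) =
      Polynomial.monomial (Finsupp.weight w e) c := by
  rw [aeval_monomial, Finsupp.prod_fintype _ _ (by simp), Finsupp.weight_apply,
    Finsupp.sum_fintype _ _ (by simp), ← Polynomial.C_mul_X_pow_eq_monomial,
    ← Finset.prod_pow_eq_pow_sum]
  refine congrArg _ (Finset.prod_congr rfl fun i _ => ?_)
  rw [← pow_mul, mul_comm, smul_eq_mul]

theorem kron_monomial (e : Fin 15 →₀ ℕ) (c : ℂ) :
    kron (monomial e c) = Polynomial.monomial (code e) c :=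
  aeval_X_pow_monomial _ e c

/-- No information is lost on polynomials with exponents below `32`. -/
theorem eq_of_kron_eq {f g : P} (hf : ∀ e ∈ f.support, ∀ i, e i < 32)
    (hg : ∀ e ∈ g.support, ∀ i, e i < 32) (h : kron f = kron g) : f = g := by
  have coeff_kron : ∀ f : P, (∀ e ∈ f.support, ∀ i, e i < 32) → ∀ e : Fin 15 →₀ ℕ,
      (∀ i, e i < 32) → (kron f).coeff (code e) = coeff e f := by
    intro f hf e he
    conv_lhs => rw [f.as_sum, map_sum, Polynomial.finsetSum_coeff]
    rw [Finset.sum_eq_single e]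
    · rw [kron_monomial, Polynomial.coeff_monomial_same]
    · intro d hd hde
      rw [kron_monomial, Polynomial.coeff_monomial_of_ne]
      exact fun h => hde (code_injOn (hf d hd) he h.symm)
    · intro h
      rw [kron_monomial, Polynomial.coeff_monomial_same, notMem_support_iff.1 h]
  ext e
  by_cases he : ∀ i, e i < 32
  · rw [← coeff_kron f hf e he, ← coeff_kron g hg e he, h]
  · rw [notMem_support_iff.1 fun h => he (hf e h), notMem_support_iff.1 fun h => he (hg e h)]

/-- As all weights are at least `2`, a bound on the weighted degree of a monomial bounds the
exponents of all monomials that are not larger in the order. -/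
theorem lt_of_le_of_weight_lt {a b : Fin 15 →₀ ℕ} (h : a ≼[order] b)
    (hb : Finsupp.weight weights b < 64) (i : Fin 15) : a i < 32 := by
  have hw : Finsupp.weight weights a ≤ Finsupp.weight weights b := by
    rcases h.lt_or_eq with h | h
    · rcases (wDegRevLex_lt_iff weights weights_pos a b).1 h with h | h
      exacts [h.le, h.1.le]
    · rw [order.toSyn.injective h]
  have h2 : ∀ i, 2 ≤ weights i := by decide
  have hi : a i * weights i ≤ Finsupp.weight weights a := by
    rw [Finsupp.weight_apply, Finsupp.sum_fintype _ _ (by simp)]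
    exact Finset.single_le_sum (f := fun i => a i • weights i) (fun _ _ => Nat.zero_le _)
      (Finset.mem_univ i)
  have := Nat.mul_le_mul_left (a i) (h2 i)
  omega

/-- The exponent vector whose entries are the digits of `n` in base `32`, reduced modulo `16`. So
the entries are below `16` whatever `n` is, and the sum of two such vectors has entries below
`32`. -/
noncomputable def digitExp (n : ℕ) : Fin 15 →₀ ℕ :=
  Finsupp.equivFunOnFinite.symm fun i => n / 32 ^ (i : ℕ) % 16

/-- The sum of the products of the entries of a list and the digits of `n` in base `32`, reduced
modulo `16`. -/
def dotDigits : List ℕ → ℕ → ℕ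
  | [], _ => 0
  | a :: l, n => a * (n % 16) + dotDigits l (n / 32)

theorem dotDigits_eq_sum (l : List ℕ) (n : ℕ) :
    dotDigits l n = ∑ i ∈ Finset.range l.length, l.getD i 0 * (n / 32 ^ i % 16) := by
  induction l generalizing n with
  | nil => simp [dotDigits]
  | cons a l ih =>
    rw [dotDigits, ih, List.length_cons, Finset.sum_range_succ', add_comm]
    simp [pow_succ', Nat.div_div_eq_div_mul]

theorem code_digitExp (n : ℕ) : code (digitExp n) = dotDigits varCodes n := by
  rw [dotDigits_eq_sum, code, Finsupp.weight_apply, Finsupp.sum_fintype _ _ (by simp),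
    Finset.sum_range]
  exact Finset.sum_congr rfl fun i _ => mul_comm _ _

/-! ### Sparse polynomials and their reduction -/

/-- A term of a sparse polynomial: an integer coefficient and the code of a monomial. -/
structure Term where
  coeff : ℤ
  code : ℕ

/-- The image under Kronecker substitution of the polynomial with the given list of terms. -/
noncomputable def toKron (p : List Term) : Polynomial ℂ :=
  (p.map fun t => Polynomial.monomial t.code (t.coeff : ℂ)).sum

@[simp]
theorem toKron_nil : toKron [] = 0 := rfl

@[simp]
theorem toKron_cons (t : Term) (p : List Term) :
    toKron (t :: p) = Polynomial.monomial t.code (t.coeff : ℂ) + toKron p := by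
  simp [toKron]

theorem toKron_append (p q : List Term) : toKron (p ++ q) = toKron p + toKron q := by
  simp [toKron]

/-- The product of a sparse polynomial and a term. -/
def mulTerm (c : ℤ) (d : ℕ) (p : List Term) : List Term :=
  p.map fun s => ⟨c * s.coeff, d + s.code⟩

theorem toKron_mulTerm (c : ℤ) (d : ℕ) (p : List Term) :
    toKron (mulTerm c d p) = Polynomial.monomial d (c : ℂ) * toKron p := by
  induction p with
  | nil => simp [mulTerm]
  | cons s p ih =>
    rw [toKron_cons, mul_add, ← ih, Polynomial.monomial_mul_monomial, ← Int.cast_mul]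
    rfl

/-- The sum of two sparse polynomials, by merging their decreasing lists of terms. The number
`n` bounds the depth of the recursion; once it is used up, the remaining lists are
concatenated. -/
def merge : ℕ → List Term → List Term → List Term
  | 0, p, q => p ++ q
  | _ + 1, [], q => q
  | _ + 1, s :: p, [] => s :: p
  | n + 1, s :: p, t :: q =>
    bif Nat.beq s.code t.code then
      bif s.coeff + t.coeff == 0 then merge n p q
      else ⟨s.coeff + t.coeff, s.code⟩ :: merge n p q
    else bif Nat.ble t.code s.code then s :: merge n p (t :: q)
    else t :: merge n (s :: p) q

theorem toKron_merge (n : ℕ) (p q : List Term) : toKron (merge n p q) = toKron p + toKron q := by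
  induction n generalizing p q with
  | zero => exact toKron_append p q
  | succ n ih =>
    cases p with
    | nil => simp [merge]
    | cons s p =>
      cases q with
      | nil => simp [merge]
      | cons t q =>
        unfold merge
        cases hc : Nat.beq s.code t.code with
        | true =>
          have hadd : Polynomial.monomial s.code ((s.coeff + t.coeff : ℤ) : ℂ) =
              Polynomial.monomial s.code (s.coeff : ℂ) +
                Polynomial.monomial t.code (t.coeff : ℂ) := by
            rw [← Nat.eq_of_beq_eq_true hc, ← map_add, Int.cast_add]
          cases h0 : s.coeff + t.coeff == 0 with
          | true =>
            rw [eq_of_beq h0, Int.cast_zero, map_zero] at hadd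
            simp only [cond_true, toKron_cons, ih]
            linear_combination hadd
          | false =>
            simp only [cond_false, cond_true, toKron_cons, ih, hadd]
            ring
        | false =>
          cases Nat.ble t.code s.code <;>
          · simp only [cond_false, cond_true, toKron_cons, ih]
            ring

/-- The number whose digits in base `32` are the exponents of the monomial with code `c`. -/
def unpack (c : ℕ) : ℕ := (32 ^ 15 - c % 32 ^ 15) % 32 ^ 15

/-- The number whose digits in base `32` are all `16`. -/
def guardBits : ℕ := 16 * ((32 ^ 15 - 1) / 31)

/-- A divisor in the reduction of sparse polynomials: the code of its leading monomial, the number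
with the exponents of that monomial as digits, and its terms other than the leading one. The
leading coefficient is `1`. -/
structure Divisor where
  code : ℕ
  digits : ℕ
  tail : List Term

/-- Look for a divisor whose leading monomial divides a given one: `n` is the sum of `guardBits` and
the number with the exponents of that monomial as digits, so a digit of the difference is at
least `16` exactly where the exponent of the divisor is not too large. Nothing depends on the
success of the search, as `reducesToZero` verifies the quotient monomial. -/
def findDivisor (n : ℕ) : List Divisor → Option Divisor
  | [] => none
  | e :: B => bif Nat.beq (Nat.land (n - e.digits) guardBits) guardBits then some e
    else findDivisor n B

theorem mem_of_findDivisor_eq_some {n : ℕ} {B : List Divisor} {e : Divisor}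
    (h : findDivisor n B = some e) : e ∈ B := by
  induction B with
  | nil => simp [findDivisor] at h
  | cons d B ih =>
    unfold findDivisor at h
    cases hd : Nat.beq (Nat.land (n - d.digits) guardBits) guardBits <;> rw [hd] at h
    · exact List.mem_cons_of_mem _ (ih h)
    · rw [cond_true, Option.some.injEq] at h
      exact h ▸ List.mem_cons_self

/-- Whether dividing `p` by the members of `B` leaves the remainder `0` after at most `n` steps,
where each leading monomial met on the way has a code smaller than `bound`. The last condition of
a step says that the quotient of the leading monomials is a monomial. -/
def reducesToZero (B : List Divisor) (bound : ℕ) : ℕ → List Term → Bool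
  | _, [] => true
  | 0, _ :: _ => false
  | n + 1, t :: p =>
    match findDivisor (unpack t.code + guardBits) B with
    | none => false
    | some e => Nat.blt t.code bound &&
      (Nat.beq (dotDigits varCodes (unpack t.code - e.digits) + e.code) t.code &&
        reducesToZero B bound n (merge 1000 p (mulTerm (-t.coeff) (t.code - e.code) e.tail)))

/-- Soundness of `reducesToZero`. The member `r` of the span is the sum of the multiples
subtracted in the division. -/
theorem exists_mem_lowerSpan_of_reducesToZero {ι : Type*} {f : ι → P} {B : List Divisor}
    (hB : ∀ e ∈ B, ∃ i, code (order.degree (f i)) = e.code ∧ (∀ v, order.degree (f i) v < 16) ∧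
      kron (f i) = Polynomial.monomial e.code 1 + toKron e.tail)
    {L : Fin 15 →₀ ℕ} {n : ℕ} {p : List Term}
    (h : reducesToZero B (code L) n p = true) :
    ∃ r ∈ lowerSpan order f L, kron r = toKron p := by
  induction n generalizing p with
  | zero =>
    cases p with
    | nil => exact ⟨0, Submodule.zero_mem _, by simp⟩
    | cons t p => simp [reducesToZero] at h
  | succ n ih =>
    cases p with
    | nil => exact ⟨0, Submodule.zero_mem _, by simp⟩
    | cons t p =>
      unfold reducesToZero at h
      cases he : findDivisor (unpack t.code + guardBits) B with
      | none => simp [he] at h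
      | some e =>
        simp only [he, Bool.and_eq_true, Nat.beq_eq, Nat.blt_eq] at h
        obtain ⟨hlt, hq, hrest⟩ := h
        obtain ⟨i, hcode, hdeg, hi⟩ := hB e (mem_of_findDivisor_eq_some he)
        obtain ⟨r, hr, hkr⟩ := ih hrest
        rw [← code_digitExp] at hq
        generalize hqd : digitExp (unpack t.code - e.digits) = d at hq
        have hd : ∀ v, d v < 16 := fun v => by
          rw [← hqd]
          exact Nat.mod_lt _ (by norm_num)
        refine ⟨monomial d (t.coeff : ℂ) * f i + r, Submodule.add_mem _
          (monomial_mul_mem_lowerSpan (lt_of_code_lt_code (fun v => ?_) ?_) _) hr, ?_⟩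
        · have h1 := hd v
          have h2 := hdeg v
          rw [Finsupp.add_apply]
          omega
        · rw [map_add, hcode, hq]
          exact hlt
        · have hsub : t.code - e.code = code d := by omega
          rw [map_add, map_mul, kron_monomial, hi, hkr, toKron_merge, toKron_mulTerm, hsub, mul_add,
            Polynomial.monomial_mul_monomial, hq, mul_one, Int.cast_neg, map_neg, toKron_cons]
          ring

/-- The exponent vector of the product of the variables with the numbers in `v`. -/
noncomputable def expOf (v : List ℕ) : Fin 15 →₀ ℕ :=
  Finsupp.equivFunOnFinite.symm fun i => v.count (i : ℕ)

@[simp]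
theorem expOf_apply (v : List ℕ) (i : Fin 15) : expOf v i = v.count (i : ℕ) := rfl

theorem expOf_nil : expOf [] = 0 := by
  ext i
  simp

theorem expOf_cons (a : ℕ) (v : List ℕ) :
    expOf (a :: v) = (if h : a < 15 then Finsupp.single ⟨a, h⟩ 1 else 0) + expOf v := by
  ext i
  rw [Finsupp.add_apply, expOf_apply, expOf_apply, List.count_cons, add_comm]
  congr 1
  split_ifs with h1 h2 h2
  · rw [beq_iff_eq] at h1
    subst h1
    simp
  · exact absurd (eq_of_beq h1 ▸ i.2) h2
  · rw [Finsupp.single_apply, if_neg]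
    rintro rfl
    simp at h1
  · rfl

theorem expOf_diff (u v : List ℕ) : expOf (u.diff v) = expOf u - expOf v := by
  ext i
  simp [List.count_diff]

theorem expOf_apply_lt {v : List ℕ} {n : ℕ} (h : v.length < n) (i : Fin 15) : expOf v i < n :=
  List.count_le_length.trans_lt h

/-- The code of the product of the variables with the numbers in `v`. -/
def codeOf (v : List ℕ) : ℕ := (v.map varCode).sum

theorem code_expOf {v : List ℕ} : code (expOf v) = codeOf v := by
  induction v with
  | nil => rw [expOf_nil, map_zero]; rfl
  | cons a v ih =>
    rw [expOf_cons, map_add, ih, codeOf, codeOf, List.map_cons, List.sum_cons]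
    congr 1
    split_ifs with h
    · simp [code, Finsupp.weight_single]
    · rw [map_zero, varCode, List.getD_eq_default _ _ (by simpa [varCodes] using h)]

/-- The polynomial whose terms have the coefficients and the products of variables in the list. -/
noncomputable def dataPoly (d : List (ℤ × List ℕ)) : P :=
  (d.map fun t => monomial (expOf t.2) (t.1 : ℂ)).sum

theorem dataPoly_nil : dataPoly [] = 0 := rfl

theorem dataPoly_cons (t : ℤ × List ℕ) (d : List (ℤ × List ℕ)) :
    dataPoly (t :: d) = monomial (expOf t.2) (t.1 : ℂ) + dataPoly d := by
  simp [dataPoly]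

theorem monomial_expOf (v : List ℕ) (c : ℂ) : monomial (expOf v) c =
    C c * (v.map fun a => if h : a < 15 then X ⟨a, h⟩ else 1 : List P).prod := by
  induction v with
  | nil => rw [expOf_nil, List.map_nil, List.prod_nil, mul_one, C_apply]
  | cons a v ih =>
    rw [expOf_cons, List.map_cons, List.prod_cons, mul_left_comm, ← ih]
    split_ifs
    · rw [X, monomial_mul, one_mul]
    · rw [zero_add, one_mul]

theorem dataPoly_cons_eq (c : ℤ) (v : List ℕ) (d : List (ℤ × List ℕ)) :
    dataPoly ((c, v) :: d) =
      c * (v.map fun a => if h : a < 15 then X ⟨a, h⟩ else 1 : List P).prod + dataPoly d := by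
  rw [dataPoly_cons, monomial_expOf, map_intCast]

theorem exists_of_mem_support_dataPoly {d : List (ℤ × List ℕ)} {e : Fin 15 →₀ ℕ}
    (h : e ∈ (dataPoly d).support) : ∃ t ∈ d, e = expOf t.2 := by
  classical
  induction d with
  | nil => simp [dataPoly_nil] at h
  | cons t d ih =>
    rw [dataPoly_cons] at h
    rcases Finset.mem_union.1 (support_add h) with h | h
    · exact ⟨t, List.mem_cons_self, Finset.mem_singleton.1 (support_monomial_subset h)⟩
    · obtain ⟨s, hs, rfl⟩ := ih h
      exact ⟨s, List.mem_cons_of_mem _ hs, rfl⟩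

/-- The sparse form of a polynomial. -/
def termsOf (d : List (ℤ × List ℕ)) : List Term := d.map fun t => ⟨t.1, codeOf t.2⟩

theorem kron_dataPoly (d : List (ℤ × List ℕ)) : kron (dataPoly d) = toKron (termsOf d) := by
  induction d with
  | nil => exact map_zero kron
  | cons t d ih =>
    rw [dataPoly_cons, map_add, ih, kron_monomial, code_expOf]
    exact (toKron_cons ⟨t.1, codeOf t.2⟩ (termsOf d)).symm

/-! ### The 61 polynomials in sparse form -/

/-- The terms of `g1` to `g6`. -/
def data1To6 : List (List (ℤ × List ℕ)) := [
  [(1, [10, 11]), (-1, [5, 13]), (-1, [0, 4]), (2, [2])],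
  [(1, [6, 11]), (-1, [0, 14]), (-1, [1, 5]), (2, [3])],
  [(1, [9, 10]), (-1, [4, 12]), (-1, [3, 5]), (2, [1])],
  [(1, [8, 9]), (-1, [3, 14]), (-1, [2, 4]), (2, [0])],
  [(1, [7, 8]), (-1, [2, 13]), (-1, [1, 3]), (2, [5])],
  [(1, [6, 7]), (-1, [1, 12]), (-1, [0, 2]), (2, [4])]]

/-- The terms of `g7` to `g9`. -/
def data7To9 : List (List (ℤ × List ℕ)) := [
  [(1, [2, 3, 4]), (-1, [0, 1, 5]), (1, [5, 6]), (-1, [4, 8]), (-1, [2, 9]), (1, [1, 11])],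
  [(1, [1, 2, 3]), (-1, [0, 4, 5]), (-1, [3, 7]), (-1, [1, 8]), (1, [0, 10]), (1, [4, 11])],
  [(1, [0, 1, 2]), (-1, [3, 4, 5]), (-1, [2, 6]), (-1, [0, 7]), (1, [5, 9]), (1, [3, 10])]]

/-- The terms of `g10` to `g15`. -/
def data10To15 : List (List (ℤ × List ℕ)) := [
  [(1, [10, 14]), (-1, [4, 6]), (-1, [5, 8]), (2, [1, 2]), (-2, [7])],
  [(1, [7, 14]), (-1, [1, 9]), (-1, [2, 11]), (2, [4, 5]), (-2, [10])],
  [(1, [9, 13]), (-1, [4, 7]), (-1, [3, 11]), (2, [0, 1]), (-2, [6])],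
  [(1, [6, 13]), (-1, [0, 8]), (-1, [1, 10]), (2, [3, 4]), (-2, [9])],
  [(1, [11, 12]), (-1, [5, 7]), (-1, [0, 9]), (2, [2, 3]), (-2, [8])],
  [(1, [8, 12]), (-1, [3, 6]), (-1, [2, 10]), (2, [0, 5]), (-2, [11])]]

/-- The terms of `g16` to `g21`. -/
def data16To21 : List (List (ℤ × List ℕ)) := [
  [(1, [2, 3, 8]), (-1, [0, 5, 11]), (-1, [8, 8]), (1, [11, 11]), (1, [0, 0]), (-1, [2, 2]),
    (-1, [3, 3]), (1, [5, 5])],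
  [(1, [1, 2, 7]), (-1, [4, 5, 10]), (-1, [7, 7]), (1, [10, 10]), (-1, [1, 1]), (-1, [2, 2]),
    (1, [4, 4]), (1, [5, 5])],
  [(1, [0, 1, 6]), (-1, [3, 4, 9]), (-1, [6, 6]), (1, [9, 9]), (-1, [0, 0]), (-1, [1, 1]),
    (1, [3, 3]), (1, [4, 4])],
  [(1, [13, 14]), (2, [3, 4, 5]), (-1, [8, 11]), (-2, [5, 9]), (-2, [3, 10]), (-1, [1, 4]),
    (2, [12])],
  [(1, [12, 14]), (2, [0, 4, 5]), (-1, [6, 9]), (-2, [0, 10]), (-2, [4, 11]), (-1, [2, 5]),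
    (2, [13])],
  [(1, [12, 13]), (2, [0, 1, 5]), (-1, [7, 10]), (-2, [5, 6]), (-2, [1, 11]), (-1, [0, 3]),
    (2, [14])]]

/-- The terms of `g22` to `g29`. -/
def data22To29 : List (List (ℤ × List ℕ)) := [
  [(1, [3, 4, 5, 5]), (-1, [5, 5, 9]), (-1, [3, 5, 10]), (-1, [1, 2, 11]), (1, [7, 11]),
    (1, [5, 12]), (1, [2, 14]), (-1, [3, 4])],
  [(1, [0, 1, 5, 5]), (-1, [5, 5, 6]), (-1, [2, 3, 10]), (-1, [1, 5, 11]), (1, [8, 10]),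
    (1, [2, 12]), (1, [5, 14]), (-1, [0, 1])],
  [(1, [0, 4, 4, 5]), (-1, [1, 2, 9]), (-1, [0, 4, 10]), (-1, [4, 4, 11]), (1, [7, 9]),
    (1, [4, 13]), (1, [1, 14]), (-1, [0, 5])],
  [(1, [3, 3, 4, 5]), (-1, [0, 1, 8]), (-1, [3, 5, 9]), (-1, [3, 3, 10]), (1, [6, 8]),
    (1, [3, 12]), (1, [0, 13]), (-1, [4, 5])],
  [(1, [0, 3, 4, 5]), (-1, [0, 5, 9]), (-1, [0, 3, 10]), (-1, [3, 4, 11]), (1, [9, 11]),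
    (1, [0, 12]), (1, [3, 13]), (-1, [1, 2])],
  [(1, [0, 1, 4, 5]), (-1, [4, 5, 6]), (-1, [0, 1, 10]), (-1, [1, 4, 11]), (1, [6, 10]),
    (1, [1, 13]), (1, [4, 14]), (-1, [2, 3])],
  [(1, [0, 0, 4, 5]), (-1, [2, 3, 6]), (-1, [0, 0, 10]), (-1, [0, 4, 11]), (1, [6, 8]),
    (1, [3, 12]), (1, [0, 13]), (-1, [4, 5])],
  [(1, [0, 1, 1, 5]), (-1, [1, 5, 6]), (-1, [3, 4, 7]), (-1, [1, 1, 11]), (1, [7, 9]),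
    (1, [4, 13]), (1, [1, 14]), (-1, [0, 5])]]

/-- The terms of `g30` to `g37`. -/
def data30To37 : List (List (ℤ × List ℕ)) := [
  [(1, [0, 4, 5, 11]), (-1, [4, 11, 11]), (-1, [0, 5, 13]), (-1, [2, 3, 14]), (1, [11, 13]),
    (1, [8, 14]), (-1, [0, 0, 4]), (-1, [4, 5, 5]), (1, [3, 9]), (1, [5, 10]), (2, [0, 2])],
  [(1, [0, 1, 5, 11]), (-1, [1, 11, 11]), (-1, [2, 3, 13]), (-1, [0, 5, 14]), (1, [8, 13]),
    (1, [11, 14]), (-1, [0, 0, 1]), (-1, [1, 5, 5]), (1, [0, 6]), (1, [2, 7]), (2, [3, 5])],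
  [(1, [3, 4, 5, 10]), (-1, [3, 10, 10]), (-1, [4, 5, 12]), (-1, [1, 2, 13]), (1, [10, 12]),
    (1, [7, 13]), (-1, [3, 4, 4]), (-1, [3, 5, 5]), (1, [2, 8]), (1, [4, 9]), (2, [1, 5])],
  [(1, [0, 4, 5, 10]), (-1, [0, 10, 10]), (-1, [1, 2, 12]), (-1, [4, 5, 13]), (1, [7, 12]),
    (1, [10, 13]), (-1, [0, 4, 4]), (-1, [0, 5, 5]), (1, [1, 6]), (1, [5, 11]), (2, [2, 4])],
  [(1, [3, 4, 5, 9]), (-1, [5, 9, 9]), (-1, [3, 4, 12]), (-1, [0, 1, 14]), (1, [9, 12]),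
    (1, [6, 14]), (-1, [3, 3, 5]), (-1, [4, 4, 5]), (1, [4, 10]), (1, [0, 11]), (2, [1, 3])],
  [(1, [0, 1, 5, 9]), (-1, [5, 6, 9]), (-1, [1, 9, 11]), (-1, [0, 1, 12]), (1, [6, 12]),
    (1, [9, 14]), (-1, [2, 3, 3]), (1, [1, 7]), (1, [3, 8])],
  [(1, [4, 5, 5, 8]), (-1, [1, 2, 2, 11]), (-1, [5, 8, 10]), (1, [2, 7, 11]), (1, [2, 2, 14]),
    (-1, [5, 5, 14]), (1, [5, 6]), (-1, [4, 8]), (-1, [2, 9]), (1, [1, 11])],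
  [(1, [0, 4, 5, 8]), (-1, [0, 8, 10]), (-1, [4, 8, 11]), (-1, [0, 5, 14]), (1, [8, 13]),
    (1, [11, 14]), (-1, [1, 2, 2]), (1, [0, 6]), (1, [2, 7])]]

/-- The terms of `g38` to `g46`. -/
def data38To46 : List (List (ℤ × List ℕ)) := [
  [(1, [0, 1, 5, 8]), (-1, [5, 6, 8]), (-1, [1, 8, 11]), (-1, [0, 5, 13]), (1, [11, 13]),
    (1, [8, 14]), (-1, [3, 3, 4]), (1, [3, 9]), (1, [5, 10])],
  [(1, [0, 0, 1, 8]), (-1, [3, 3, 4, 11]), (-1, [0, 6, 8]), (1, [3, 9, 11]), (-1, [0, 0, 13]),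
    (1, [3, 3, 13]), (-1, [3, 7]), (-1, [1, 8]), (1, [0, 10]), (1, [4, 11])],
  [(1, [0, 5, 5, 7]), (-1, [2, 2, 3, 10]), (1, [2, 8, 10]), (-1, [5, 7, 11]), (1, [2, 2, 12]),
    (-1, [5, 5, 12]), (-1, [2, 6]), (-1, [0, 7]), (1, [5, 9]), (1, [3, 10])],
  [(1, [3, 4, 5, 7]), (-1, [5, 7, 9]), (-1, [3, 7, 10]), (-1, [4, 5, 13]), (1, [7, 12]),
    (1, [10, 13]), (-1, [0, 1, 1]), (1, [1, 6]), (1, [5, 11])],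
  [(1, [0, 4, 5, 7]), (-1, [0, 7, 10]), (-1, [4, 7, 11]), (-1, [4, 5, 12]), (1, [10, 12]),
    (1, [7, 13]), (-1, [2, 2, 3]), (1, [2, 8]), (1, [4, 9])],
  [(1, [3, 4, 4, 7]), (-1, [0, 1, 1, 10]), (-1, [4, 7, 9]), (1, [1, 6, 10]), (1, [1, 1, 13]),
    (-1, [4, 4, 13]), (-1, [3, 7]), (-1, [1, 8]), (1, [0, 10]), (1, [4, 11])],
  [(1, [4, 4, 5, 6]), (-1, [1, 1, 2, 9]), (1, [1, 7, 9]), (-1, [4, 6, 10]), (1, [1, 1, 14]),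
    (-1, [4, 4, 14]), (-1, [5, 6]), (1, [4, 8]), (1, [2, 9]), (-1, [1, 11])],
  [(1, [3, 4, 5, 6]), (-1, [5, 6, 9]), (-1, [3, 6, 10]), (-1, [3, 4, 14]), (1, [6, 12]),
    (1, [9, 14]), (-1, [1, 1, 2]), (1, [1, 7]), (1, [3, 8])],
  [(1, [2, 3, 3, 6]), (-1, [0, 0, 5, 9]), (-1, [3, 6, 8]), (1, [0, 9, 11]), (1, [0, 0, 12]),
    (-1, [3, 3, 12]), (-1, [2, 6]), (-1, [0, 7]), (1, [5, 9]), (1, [3, 10])]]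

/-- The terms of `g47` to `g54`. -/
def data47To54 : List (List (ℤ × List ℕ)) := [
  [(1, [0, 1, 5, 14]), (-1, [5, 6, 14]), (-1, [1, 11, 14]), (1, [14, 14]), (-1, [3, 4, 9]),
    (-1, [0, 5, 11]), (1, [9, 9]), (1, [11, 11]), (1, [4, 4]), (1, [5, 5]), (-4, [])],
  [(1, [0, 4, 5, 13]), (-1, [0, 10, 13]), (-1, [4, 11, 13]), (1, [13, 13]), (-1, [4, 5, 10]),
    (-1, [0, 5, 11]), (1, [10, 10]), (1, [11, 11]), (1, [0, 0]), (-1, [2, 2]), (1, [4, 4]),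
    (1, [5, 5]), (-4, [])],
  [(1, [3, 4, 5, 12]), (-1, [5, 9, 12]), (-1, [3, 10, 12]), (1, [12, 12]), (-1, [3, 4, 9]),
    (-1, [4, 5, 10]), (1, [9, 9]), (1, [10, 10]), (-1, [1, 1]), (1, [3, 3]), (1, [4, 4]),
    (1, [5, 5]), (-4, [])],
  [(1, [0, 5, 9, 11]), (-1, [2, 3, 3, 14]), (-1, [9, 11, 11]), (1, [3, 8, 14]), (-1, [0, 5, 7]),
    (-1, [0, 0, 9]), (1, [3, 3, 9]), (-1, [5, 5, 9]), (2, [0, 2, 3]), (1, [7, 11]), (1, [5, 12]),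
    (1, [2, 14]), (-2, [0, 8]), (-1, [3, 4])],
  [(1, [3, 4, 9, 11]), (-1, [0, 0, 1, 14]), (-1, [9, 9, 11]), (1, [0, 6, 14]), (-1, [3, 4, 7]),
    (1, [0, 0, 11]), (-1, [3, 3, 11]), (-1, [4, 4, 11]), (2, [0, 1, 3]), (1, [7, 9]),
    (1, [4, 13]), (1, [1, 14]), (-2, [3, 6]), (-1, [0, 5])],
  [(1, [1, 2, 9, 11]), (-1, [7, 9, 11]), (-1, [2, 9, 14]), (-1, [1, 11, 14]), (-1, [4, 4, 5, 5]),
    (1, [14, 14]), (1, [4, 5, 10]), (1, [9, 9]), (1, [11, 11]), (1, [4, 4]), (1, [5, 5]),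
    (-4, [])],
  [(1, [0, 5, 7, 11]), (-1, [2, 2, 3, 13]), (-1, [7, 11, 11]), (1, [2, 8, 13]), (-1, [0, 0, 7]),
    (1, [2, 2, 7]), (-1, [5, 5, 7]), (-1, [0, 5, 9]), (2, [2, 3, 5]), (1, [9, 11]), (1, [0, 12]),
    (1, [3, 13]), (-2, [5, 8]), (-1, [1, 2])],
  [(1, [3, 4, 7, 11]), (-1, [7, 9, 11]), (-1, [3, 7, 13]), (-1, [4, 11, 13]), (-1, [0, 0, 1, 1]),
    (1, [13, 13]), (1, [3, 4, 9]), (1, [6, 6]), (1, [7, 7]), (-1, [9, 9]), (1, [11, 11]),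
    (2, [0, 0]), (2, [1, 1]), (-1, [3, 3]), (-1, [4, 4]), (-4, [])]]

/-- The terms of `g55` to `g61`. -/
def data55To61 : List (List (ℤ × List ℕ)) := [
  [(1, [4, 5, 8, 10]), (-1, [1, 2, 2, 13]), (-1, [8, 10, 10]), (1, [2, 7, 13]), (-1, [4, 5, 6]),
    (1, [2, 2, 8]), (-1, [4, 4, 8]), (-1, [5, 5, 8]), (2, [1, 2, 5]), (1, [6, 10]), (1, [1, 13]),
    (1, [4, 14]), (-2, [5, 7]), (-1, [2, 3])],
  [(1, [0, 1, 8, 10]), (-1, [6, 8, 10]), (-1, [1, 8, 13]), (-1, [0, 10, 13]), (-1, [3, 3, 4, 4]),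
    (1, [13, 13]), (1, [3, 4, 9]), (1, [8, 8]), (1, [10, 10]), (1, [3, 3]), (1, [4, 4]),
    (-4, [])],
  [(1, [4, 5, 6, 10]), (-1, [1, 1, 2, 12]), (-1, [6, 10, 10]), (1, [1, 7, 12]), (1, [1, 1, 6]),
    (-1, [4, 4, 6]), (-1, [5, 5, 6]), (-1, [4, 5, 8]), (2, [1, 2, 4]), (1, [8, 10]), (1, [2, 12]),
    (1, [5, 14]), (-2, [4, 7]), (-1, [0, 1])],
  [(1, [2, 3, 6, 10]), (-1, [6, 8, 10]), (-1, [2, 6, 12]), (-1, [3, 10, 12]), (-1, [0, 0, 5, 5]),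
    (1, [12, 12]), (1, [0, 5, 11]), (1, [6, 6]), (1, [10, 10]), (1, [0, 0]), (1, [5, 5]),
    (-4, [])],
  [(1, [0, 5, 7, 9]), (-1, [7, 9, 11]), (-1, [0, 7, 12]), (-1, [5, 9, 12]), (-1, [2, 2, 3, 3]),
    (1, [12, 12]), (1, [0, 5, 11]), (1, [7, 7]), (1, [8, 8]), (1, [9, 9]), (-1, [11, 11]),
    (-1, [0, 0]), (2, [2, 2]), (2, [3, 3]), (-1, [5, 5]), (-4, [])],
  [(1, [3, 4, 7, 9]), (-1, [0, 1, 1, 12]), (-1, [7, 9, 9]), (1, [1, 6, 12]), (1, [1, 1, 7]),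
    (-1, [3, 3, 7]), (-1, [4, 4, 7]), (-1, [3, 4, 11]), (2, [0, 1, 4]), (1, [9, 11]),
    (1, [0, 12]), (1, [3, 13]), (-2, [4, 6]), (-1, [1, 2])],
  [(1, [4, 5, 6, 8]), (-1, [6, 8, 10]), (-1, [5, 6, 14]), (-1, [4, 8, 14]), (-1, [1, 1, 2, 2]),
    (1, [14, 14]), (1, [4, 5, 10]), (1, [6, 6]), (1, [7, 7]), (1, [8, 8]), (-1, [10, 10]),
    (2, [1, 1]), (2, [2, 2]), (-1, [4, 4]), (-1, [5, 5]), (-4, [])]]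

/-- The terms of the 61 polynomials in decreasing order, each with its coefficient and the numbers,
from `0` to `14`, of the variables in its monomial. -/
def data : List (List (ℤ × List ℕ)) :=
  data1To6 ++ data7To9 ++ data10To15 ++ data16To21 ++ data22To29 ++
    data30To37 ++ data38To46 ++ data47To54 ++ data55To61

theorem map_dataPoly_data1To6 : data1To6.map dataPoly = [g1, g2, g3, g4, g5, g6] := by
  simp only [data1To6, List.map_cons, List.map_nil, dataPoly_cons_eq, dataPoly_nil]
  simp [g1, g2, g3, g4, g5, g6]
  and_intros <;> ring

theorem map_dataPoly_data7To9 : data7To9.map dataPoly = [g7, g8, g9] := by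
  simp only [data7To9, List.map_cons, List.map_nil, dataPoly_cons_eq, dataPoly_nil]
  simp [g7, g8, g9]
  and_intros <;> ring

theorem map_dataPoly_data10To15 : data10To15.map dataPoly = [g10, g11, g12, g13, g14, g15] := by
  simp only [data10To15, List.map_cons, List.map_nil, dataPoly_cons_eq, dataPoly_nil]
  simp [g10, g11, g12, g13, g14, g15]
  and_intros <;> ring

theorem map_dataPoly_data16To21 : data16To21.map dataPoly = [g16, g17, g18, g19, g20, g21] := by
  simp only [data16To21, List.map_cons, List.map_nil, dataPoly_cons_eq, dataPoly_nil]
  simp [g16, g17, g18, g19, g20, g21]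
  and_intros <;> ring

theorem map_dataPoly_data22To29 : data22To29.map dataPoly = [g22, g23, g24, g25, g26, g27, g28,
  g29] := by
  simp only [data22To29, List.map_cons, List.map_nil, dataPoly_cons_eq, dataPoly_nil]
  simp [g22, g23, g24, g25, g26, g27, g28, g29]
  and_intros <;> ring

theorem map_dataPoly_data30To37 : data30To37.map dataPoly = [g30, g31, g32, g33, g34, g35, g36,
  g37] := by
  simp only [data30To37, List.map_cons, List.map_nil, dataPoly_cons_eq, dataPoly_nil]
  simp [g30, g31, g32, g33, g34, g35, g36, g37]
  and_intros <;> ring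

theorem map_dataPoly_data38To46 : data38To46.map dataPoly = [g38, g39, g40, g41, g42, g43, g44,
  g45, g46] := by
  simp only [data38To46, List.map_cons, List.map_nil, dataPoly_cons_eq, dataPoly_nil]
  simp [g38, g39, g40, g41, g42, g43, g44, g45, g46]
  and_intros <;> ring

theorem map_dataPoly_data47To54 : data47To54.map dataPoly = [g47, g48, g49, g50, g51, g52, g53,
  g54] := by
  simp only [data47To54, List.map_cons, List.map_nil, dataPoly_cons_eq, dataPoly_nil]
  simp [g47, g48, g49, g50, g51, g52, g53, g54]
  and_intros <;> ring

theorem map_dataPoly_data55To61 : data55To61.map dataPoly = [g55, g56, g57, g58, g59, g60, g61] :=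
  by
  simp only [data55To61, List.map_cons, List.map_nil, dataPoly_cons_eq, dataPoly_nil]
  simp [g55, g56, g57, g58, g59, g60, g61]
  and_intros <;> ring

theorem g_eq_dataPoly (k : Fin 61) : g k = dataPoly (data.getD k []) := by
  have h : dataPoly (data.getD k []) = (data.map dataPoly).getD k 0 := by
    simp [List.getD_eq_getElem?_getD, List.getElem?_map, Option.getD_map, ← dataPoly_nil]
  rw [h, data]
  simp only [List.map_append, map_dataPoly_data1To6, map_dataPoly_data7To9,
    map_dataPoly_data10To15, map_dataPoly_data16To21, map_dataPoly_data22To29,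
    map_dataPoly_data30To37, map_dataPoly_data38To46, map_dataPoly_data47To54,
    map_dataPoly_data55To61]
  fin_cases k <;> rfl

/-! ### Verification of the S-polynomials -/

/-- The divisor given by a polynomial with leading coefficient `1`. -/
def divisorOf : List (ℤ × List ℕ) → Divisor
  | [] => ⟨0, 0, []⟩
  | t :: p => ⟨codeOf t.2, unpack (codeOf t.2), termsOf p⟩

/-- The variables of the leading monomial. -/
def leadOf (d : List (ℤ × List ℕ)) : List ℕ := (d.headD (0, [])).2

/-- Whether the first term has coefficient `1`, the codes of the other terms are smaller than that
of the first one, and no term has more than seven variables. The last condition keeps the weighted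
degrees of the least common multiples below `64`. -/
def isMonic : List (ℤ × List ℕ) → Bool
  | [] => false
  | t :: p => t.1 == 1 && Nat.ble t.2.length 7 &&
      p.all fun s => Nat.blt (codeOf s.2) (codeOf t.2) && Nat.ble s.2.length 7

/-- Whether the S-polynomial of two polynomials with leading coefficient `1` reduces to `0` by
`B`, or is known to do so as the leading monomials are coprime. -/
def sPolyReduces (B : List Divisor) (a b : List (ℤ × List ℕ)) : Bool :=
  let u := leadOf a
  let v := leadOf b
  (u.all fun x => !v.elem x) ||
    reducesToZero B (codeOf u + codeOf (v.diff u)) 1000 (merge 1000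
      (mulTerm 1 (codeOf (v.diff u)) (termsOf a.tail))
      (mulTerm (-1) (codeOf (u.diff v)) (termsOf b.tail)))

/-- Whether the product of the variables in `w` divides the least common multiple of those of the
variables in `u` and in `v`. -/
def dvdLcm (w u v : List ℕ) : Bool :=
  w.all fun x => Nat.ble (w.count x) (u.count x) || Nat.ble (w.count x) (v.count x)

/-- The `i`-th list holds the indices `k < i` for which the S-polynomial of the `i`-th and the
`k`-th polynomial is verified, where the polynomials are numbered from `0`. For each `j < i`, the
least common multiple of the `i`-th and the `j`-th leading monomial is divisible by the `k`-th one
for some such `k`. -/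
def partners : List (List ℕ) :=
  [[], [0], [0], [1, 2], [0, 1, 3], [1, 2, 4], [0, 1, 2, 3, 4, 5], [0, 1, 2, 3, 4, 5, 6],
    [0, 1, 2, 3, 4, 5, 7], [0, 2, 4, 5, 6, 7, 8], [4, 5, 6, 7, 8, 9], [1, 2, 3, 5, 6, 7, 8, 10],
    [1, 5, 6, 7, 8, 9, 11], [0, 1, 3, 4, 6, 7, 8, 10, 11], [3, 4, 6, 7, 8, 9, 12, 13],
    [0, 1, 3, 4, 6, 7, 9, 12, 14], [0, 2, 4, 5, 7, 8, 10, 11, 13], [1, 2, 3, 5, 8, 9, 12, 14],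
    [6, 7, 8, 9, 10, 11, 12, 13, 14, 15], [6, 7, 8, 9, 10, 13, 14, 17, 18],
    [6, 7, 8, 11, 12, 13, 14, 16, 18],
    [0, 1, 2, 3, 4, 5, 6, 9, 10, 11, 12, 13, 14, 17, 18, 19, 20],
    [0, 2, 3, 4, 8, 9, 10, 11, 13, 14, 17, 18, 19, 20, 21],
    [0, 1, 2, 3, 4, 5, 6, 8, 9, 10, 11, 12, 13, 14, 17, 18, 19, 20, 21, 22],
    [0, 1, 2, 3, 4, 5, 6, 9, 10, 11, 12, 13, 14, 17, 18, 19, 20, 21, 23],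
    [0, 1, 2, 3, 4, 5, 6, 9, 10, 11, 12, 13, 14, 17, 18, 19, 20, 21, 23, 24],
    [0, 2, 3, 4, 8, 9, 10, 11, 13, 14, 17, 18, 19, 20, 22, 23, 25],
    [0, 1, 2, 3, 4, 5, 9, 10, 11, 12, 13, 14, 18, 19, 20, 23, 25, 26],
    [0, 2, 3, 4, 8, 9, 10, 11, 13, 14, 17, 18, 19, 20, 22, 26],
    [0, 1, 3, 4, 10, 11, 13, 18, 23, 25, 26, 27], [0, 1, 3, 4, 8, 10, 11, 13, 18, 22, 26, 28],
    [0, 2, 4, 5, 6, 9, 12, 14, 20, 21, 24, 25], [0, 2, 4, 5, 9, 12, 14, 20, 23, 26, 27, 31],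
    [1, 2, 3, 5, 6, 10, 11, 13, 19, 21, 24, 25], [2, 3, 8, 10, 11, 17, 19, 22, 26, 28, 30],
    [0, 1, 3, 4, 9, 12, 14, 18, 21, 23, 26, 27, 29, 32],
    [3, 4, 12, 14, 18, 23, 25, 26, 27, 29, 32, 35], [3, 4, 8, 9, 14, 17, 18, 22, 26, 28, 30],
    [0, 3, 4, 8, 9, 14, 17, 18, 37], [0, 2, 4, 5, 10, 11, 13, 20, 22, 23, 25, 27, 29, 32],
    [4, 5, 6, 10, 13, 20, 21, 24, 25, 31, 33], [5, 10, 11, 20, 23, 25, 26, 27, 29, 32, 36, 39],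
    [0, 2, 4, 5, 6, 10, 11, 13, 20, 40], [1, 2, 3, 5, 6, 9, 12, 14, 19, 21, 23, 24, 31, 33, 35],
    [1, 6, 12, 14, 19, 21, 24, 25, 31, 33, 40, 43], [1, 2, 5, 6, 7, 9, 12, 15, 19],
    [8, 9, 10, 17, 18, 19, 22, 26, 28, 30, 34, 37],
    [11, 12, 18, 20, 23, 25, 26, 27, 29, 32, 36, 41],
    [6, 13, 14, 19, 20, 21, 24, 25, 31, 33, 40, 44], [1, 2, 3, 10, 11, 13, 29, 34, 39],
    [0, 1, 3, 6, 10, 11, 13, 33, 42], [0, 1, 3, 7, 8, 11, 13, 16],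
    [0, 4, 5, 10, 13, 30, 39, 41, 49], [0, 1, 4, 6, 10, 13, 40, 42, 50],
    [0, 3, 4, 9, 12, 14, 31, 35, 36, 43], [0, 2, 4, 8, 9, 14, 17, 37, 38],
    [1, 2, 5, 9, 12, 32, 43, 44, 54], [0, 2, 5, 6, 7, 9, 12, 15, 45],
    [2, 4, 5, 10, 11, 34, 39, 41, 49], [2, 3, 5, 6, 10, 11, 40, 42, 50],
    [1, 3, 4, 12, 14, 35, 36, 43, 44, 54]]

/-- Whether the `i`-th row of `partners` serves its purpose: for each `j < i` it has an entry `k <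
i` such that the `k`-th leading monomial divides the least common multiple of the `i`-th and the
`j`-th one, and the S-polynomials of the `i`-th polynomial and the entries reduce to `0`. -/
def pairsReduce (B : List Divisor) (i : ℕ) : Bool :=
  (List.range i).all (fun j => (partners.getD i []).any fun k => Nat.blt k i &&
    dvdLcm (leadOf (data.getD k [])) (leadOf (data.getD i [])) (leadOf (data.getD j []))) &&
  (partners.getD i []).all fun k => sPolyReduces B (data.getD i []) (data.getD k [])

/-- A test that the product of the variables in `u` does not divide that of the variables in `v`.
The comparison of codes settles most cases, as the code of a divisor is not larger. -/
def notDvd (u v : List ℕ) : Bool :=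
  Nat.blt (codeOf v) (codeOf u) || u.any fun x => Nat.blt x 15 && Nat.blt (v.count x) (u.count x)

/-- Whether the `i`-th leading monomial divides no monomial of another one of the polynomials. -/
def noneDivides (i : ℕ) : Bool :=
  (List.range 61).all fun j => Nat.beq i j ||
    (data.getD j []).all fun t => notDvd (leadOf (data.getD i [])) t.2

set_option maxRecDepth 10000 in
theorem isMonic_data : data.all isMonic = true := by decide +kernel

set_option maxRecDepth 10000 in
theorem noneDivides_lt : (List.range 61).all noneDivides = true := by decide +kernel

set_option maxRecDepth 10000 in
/-- The reduction of all S-polynomials that Buchberger's criterion asks for, by evaluation. -/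
theorem pairsReduce_lt : (List.range 61).all (pairsReduce (data.map divisorOf)) = true := by
  decide +kernel

/-! ### The hypotheses of Buchberger's criterion for the 61 polynomials -/

/-- The exponent vector of the leading monomial of `g k`. -/
noncomputable def leadExp (k : Fin 61) : Fin 15 →₀ ℕ := expOf (leadOf (data.getD k []))

/-- The polynomial `g k` without its leading term. -/
noncomputable def tailPoly (k : Fin 61) : P := dataPoly (data.getD k []).tail

theorem length_data : data.length = 61 := by decide +kernel

theorem getD_mem_data (k : Fin 61) : data.getD k [] ∈ data := by
  have h : (k : ℕ) < data.length := by rw [length_data]; exact k.2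
  rw [List.getD_eq_getElem _ _ h]
  exact List.getElem_mem h

theorem exists_data_eq_cons (k : Fin 61) :
    data.getD k [] = (1, leadOf (data.getD k [])) :: (data.getD k []).tail ∧
      (leadOf (data.getD k [])).length ≤ 7 ∧
      ∀ s ∈ (data.getD k []).tail, codeOf s.2 < codeOf (leadOf (data.getD k [])) ∧
        s.2.length ≤ 7 := by
  have h := List.all_eq_true.1 isMonic_data _ (getD_mem_data k)
  generalize data.getD k [] = d at h
  cases d with
  | nil => simp [isMonic] at h
  | cons t p =>
    simp only [isMonic, Bool.and_eq_true, beq_iff_eq, Nat.ble_eq, List.all_eq_true,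
      Nat.blt_eq] at h
    exact ⟨by rw [← h.1.1]; rfl, h.1.2, h.2⟩

theorem g_eq (k : Fin 61) : g k = monomial (leadExp k) 1 + tailPoly k := by
  rw [g_eq_dataPoly, (exists_data_eq_cons k).1, dataPoly_cons, Int.cast_one]
  rfl

theorem lt_of_mem_support_tailPoly (k : Fin 61) :
    ∀ e ∈ (tailPoly k).support, e ≺[order] leadExp k := by
  intro e he
  obtain ⟨s, hs, rfl⟩ := exists_of_mem_support_dataPoly he
  obtain ⟨-, -, h⟩ := exists_data_eq_cons k
  refine lt_of_code_lt_code (fun i => expOf_apply_lt ((h s hs).2.trans_lt (by norm_num)) i) ?_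
  rw [leadExp, code_expOf, code_expOf]
  exact (h s hs).1

theorem degree_g (k : Fin 61) : order.degree (g k) = leadExp k := by
  rw [g_eq, degree_monomial_add_of_lt (lt_of_mem_support_tailPoly k)]

theorem monic_g (k : Fin 61) : order.Monic (g k) := by
  rw [g_eq]
  exact monic_monomial_add_of_lt (lt_of_mem_support_tailPoly k)

theorem kron_tailPoly (k : Fin 61) :
    kron (tailPoly k) = toKron (termsOf (data.getD k []).tail) := kron_dataPoly _

theorem kron_g (k : Fin 61) : kron (g k) =
    Polynomial.monomial (code (leadExp k)) 1 + toKron (termsOf (data.getD k []).tail) := by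
  rw [g_eq, map_add, kron_monomial, kron_tailPoly]

theorem exists_of_mem_divisors (e : Divisor) (he : e ∈ data.map divisorOf) :
    ∃ k, code (order.degree (g k)) = e.code ∧ (∀ v, order.degree (g k) v < 16) ∧
      kron (g k) = Polynomial.monomial e.code 1 + toKron e.tail := by
  obtain ⟨d, hd, rfl⟩ := List.mem_map.1 he
  obtain ⟨n, hn, hd⟩ := List.mem_iff_getElem.1 hd
  let k : Fin 61 := ⟨n, length_data ▸ hn⟩
  have hk : data.getD k [] = d := by rw [List.getD_eq_getElem _ _ hn, hd]
  obtain ⟨h1, h2, -⟩ := exists_data_eq_cons k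
  have hdiv : (divisorOf d).code = code (leadExp k) ∧
      (divisorOf d).tail = termsOf (data.getD k []).tail := by
    rw [← hk, h1, leadExp, code_expOf]
    exact ⟨rfl, rfl⟩
  refine ⟨k, by rw [degree_g, hdiv.1], fun v => ?_, by rw [kron_g, hdiv.1, hdiv.2]⟩
  rw [degree_g]
  exact expOf_apply_lt (h2.trans_lt (by norm_num)) v

theorem weight_expOf_le (v : List ℕ) : Finsupp.weight weights (expOf v) ≤ 4 * v.length := by
  induction v with
  | nil => simp [expOf_nil]
  | cons a v ih =>
    have h4 : ∀ i, weights i ≤ 4 := by decide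
    rw [expOf_cons, map_add, List.length_cons]
    split_ifs with h
    · have := h4 ⟨a, h⟩
      rw [Finsupp.weight_single, one_smul]
      omega
    · rw [map_zero]
      omega

theorem weight_sup_leadExp_lt (i j : Fin 61) :
    Finsupp.weight weights (leadExp i ⊔ leadExp j) < 64 := by
  obtain ⟨c, hc⟩ := exists_add_of_le (sup_le (le_self_add : leadExp i ≤ leadExp i + leadExp j)
    le_add_self)
  have h := congrArg (Finsupp.weight weights) hc
  rw [map_add, map_add] at h
  have hi := weight_expOf_le (leadOf (data.getD i []))
  have hj := weight_expOf_le (leadOf (data.getD j []))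
  have hi' := (exists_data_eq_cons i).2.1
  have hj' := (exists_data_eq_cons j).2.1
  unfold leadExp at h ⊢
  omega

theorem sup_tsub_left (a b : Fin 15 →₀ ℕ) : (a ⊔ b) - a = b - a := by
  ext i
  simp only [Finsupp.tsub_apply, Finsupp.sup_apply]
  omega

/-- The leading terms of the two products in the S-polynomial cancel. -/
theorem kron_sPoly (i j : Fin 61) : kron (sPoly order g i j) =
    Polynomial.monomial (code (leadExp j - leadExp i)) 1 * toKron (termsOf (data.getD i []).tail) -
      Polynomial.monomial (code (leadExp i - leadExp j)) 1 *
        toKron (termsOf (data.getD j []).tail) := by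
  have hi : leadExp j - leadExp i + leadExp i = leadExp i ⊔ leadExp j := by
    rw [← sup_tsub_left, tsub_add_cancel_of_le le_sup_left]
  have hj : leadExp i - leadExp j + leadExp j = leadExp i ⊔ leadExp j := by
    rw [← sup_tsub_left, sup_comm, tsub_add_cancel_of_le le_sup_right]
  rw [sPoly, degree_g, degree_g, sup_tsub_left, sup_comm, sup_tsub_left, map_sub, map_mul, map_mul,
    kron_monomial, kron_monomial, kron_g, kron_g, mul_add, mul_add,
    Polynomial.monomial_mul_monomial, Polynomial.monomial_mul_monomial, ← map_add, ← map_add, hi,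
    hj]
  ring

theorem sPoly_mem_lowerSpan_of_sPolyReduces {i j : Fin 61}
    (h : sPolyReduces (data.map divisorOf) (data.getD i []) (data.getD j []) = true) :
    sPoly order g i j ∈
      lowerSpan order g (order.degree (g i) ⊔ order.degree (g j)) := by
  simp only [sPolyReduces, Bool.or_eq_true, List.all_eq_true] at h
  rcases h with h | h
  · refine sPoly_mem_lowerSpan_of_disjoint (t := tailPoly) (fun k => ?_) (fun k => ?_) ?_
    · rw [degree_g, ← g_eq]
    · rw [degree_g]
      exact lt_of_mem_support_tailPoly k
    · rw [degree_g, degree_g]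
      ext x
      rw [Finsupp.sup_apply, Finsupp.add_apply]
      by_cases hx : (x : ℕ) ∈ leadOf (data.getD i [])
      · have : leadExp j x = 0 := List.count_eq_zero.2 (by simpa using h _ hx)
        simp [this]
      · have : leadExp i x = 0 := List.count_eq_zero.2 hx
        simp [this]
  · rw [degree_g, degree_g]
    have hL : leadExp i + (leadExp j - leadExp i) = leadExp i ⊔ leadExp j := by
      rw [← sup_tsub_left, add_tsub_cancel_of_le le_sup_left]
    have hcode : codeOf (leadOf (data.getD i [])) + codeOf ((leadOf (data.getD j [])).diff
        (leadOf (data.getD i []))) = code (leadExp i ⊔ leadExp j) := by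
      rw [← hL, map_add, leadExp, leadExp, ← expOf_diff, code_expOf, code_expOf]
    rw [hcode] at h
    obtain ⟨r, hr, hk⟩ := exists_mem_lowerSpan_of_reducesToZero exists_of_mem_divisors h
    -- The division is known to be correct after Kronecker substitution only, which is enough as all
    -- exponents are small.
    have hw := weight_sup_leadExp_lt i j
    have heq : sPoly order g i j = r := by
      refine eq_of_kron_eq (fun e he => lt_of_le_of_weight_lt ?_ hw)
        (fun e he => lt_of_le_of_weight_lt (lt_of_mem_support_of_mem_lowerSpan hr e he).le hw) ?_
      · have := (order.le_degree he).trans (degree_sPoly_le i j)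
        rwa [degree_g, degree_g] at this
      · rw [hk, toKron_merge, toKron_mulTerm, toKron_mulTerm, kron_sPoly, leadExp, leadExp,
          ← expOf_diff, ← expOf_diff, code_expOf, code_expOf]
        simp only [Int.cast_one, Int.cast_neg, map_neg]
        ring
    rw [heq]
    exact hr

theorem exists_sPoly_mem_lowerSpan (i j : Fin 61) (hji : j < i) :
    ∃ k < i, order.degree (g k) ≤ order.degree (g i) ⊔ order.degree (g j) ∧
      sPoly order g i k ∈ lowerSpan order g (order.degree (g i) ⊔ order.degree (g k)) := by
  have h := List.all_eq_true.1 pairsReduce_lt i (List.mem_range.2 i.2)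
  simp only [pairsReduce, Bool.and_eq_true, List.all_eq_true, List.mem_range, List.any_eq_true,
    Nat.blt_eq] at h
  obtain ⟨k, hk, hki, hdvd⟩ := h.1 j hji
  refine ⟨⟨k, hki.trans i.2⟩, hki, ?_, sPoly_mem_lowerSpan_of_sPolyReduces (h.2 k hk)⟩
  rw [degree_g, degree_g, degree_g]
  intro x
  rw [Finsupp.sup_apply]
  by_cases hx : (x : ℕ) ∈ leadOf (data.getD k [])
  · have := List.all_eq_true.1 hdvd _ hx
    simp only [Bool.or_eq_true, Nat.ble_eq] at this
    exact le_sup_iff.2 this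
  · have : leadExp ⟨k, hki.trans i.2⟩ x = 0 := List.count_eq_zero.2 hx
    simp [this]

theorem not_degree_le_of_mem_support (i j : Fin 61) (hij : i ≠ j) :
    ∀ d ∈ (g j).support, ¬ order.degree (g i) ≤ d := by
  intro d hd hle
  rw [g_eq_dataPoly] at hd
  obtain ⟨t, ht, rfl⟩ := exists_of_mem_support_dataPoly hd
  rw [degree_g] at hle
  have h := List.all_eq_true.1 noneDivides_lt i (List.mem_range.2 i.2)
  simp only [noneDivides, List.all_eq_true, List.mem_range, Bool.or_eq_true, Nat.beq_eq] at h
  have h := ((h j j.2).resolve_left fun h => hij (Fin.ext h)) t ht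
  simp only [notDvd, Bool.or_eq_true, Nat.blt_eq, List.any_eq_true, Bool.and_eq_true] at h
  rcases h with h | ⟨x, -, hx, h⟩
  · obtain ⟨c, hc⟩ := exists_add_of_le hle
    have := congrArg code hc
    rw [map_add, leadExp, code_expOf, code_expOf] at this
    omega
  · exact absurd (hle ⟨x, hx⟩) h.not_ge

/-! ### The ideal generated by the 61 polynomials

The relators are combinations of the 61 polynomials and conversely. Apart from those that
come from the relators directly, each polynomial is, up to a factor `±1` or `±2`, the remainder of
an S-polynomial of others that are already known to lie in the ideal; only `g49` needs the Casimir
relator. The right-hand sides below are these S-polynomials minus the multiples subtracted in their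
reduction. -/

theorem relJ1_0 : relJ1 0 = -g4 := by
  simp [relJ1, O, OO, OOO, g4]
  ring

theorem relJ1_1 : relJ1 1 = -g3 := by
  simp [relJ1, O, OO, OOO, g3]
  ring

theorem relJ1_2 : relJ1 2 = -g1 := by
  simp [relJ1, O, OO, OOO, g1]
  ring

theorem relJ1_3 : relJ1 3 = -g2 := by
  simp [relJ1, O, OO, OOO, g2]
  ring

theorem relJ1_4 : relJ1 4 = -g6 := by
  simp [relJ1, O, OO, OOO, g6]
  ring

theorem relJ1_5 : relJ1 5 = -g5 := by
  simp [relJ1, O, OO, OOO, g5]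
  ring

theorem relJ2_0 : relJ2 0 = g12 := by
  simp [relJ2, O, OO, OOO, g12]
  ring

theorem relJ2_1 : relJ2 1 = g10 := by
  simp [relJ2, O, OO, OOO, g10]
  ring

theorem relJ2_2 : relJ2 2 = g14 := by
  simp [relJ2, O, OO, OOO, g14]
  ring

theorem relJ2_3 : relJ2 3 = g13 := by
  simp [relJ2, O, OO, OOO, g13]
  ring

theorem relJ2_4 : relJ2 4 = g11 := by
  simp [relJ2, O, OO, OOO, g11]
  ring

theorem relJ2_5 : relJ2 5 = g15 := by
  simp [relJ2, O, OO, OOO, g15]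
  ring

theorem relJ3_0 : relJ3 0 = g21 := by
  simp [relJ3, O, OO, OOO, g21]
  ring

theorem relJ3_1 : relJ3 1 = g19 + 2 * g9 := by
  simp [relJ3, O, OO, OOO, g19, g9]
  ring

theorem relJ3_2 : relJ3 2 = g20 + 2 * g8 := by
  simp [relJ3, O, OO, OOO, g20, g8]
  ring

theorem relJ3_3 : relJ3 3 = g21 + 2 * g7 := by
  simp [relJ3, O, OO, OOO, g21, g7]
  ring

theorem relJ3_4 : relJ3 4 = g19 := by
  simp [relJ3, O, OO, OOO, g19]
  ring

theorem relJ3_5 : relJ3 5 = g20 := by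
  simp [relJ3, O, OO, OOO, g20]
  ring

theorem relCasimir_eq : relCasimir = O₁ * g4 + O₆ * g5 + O₃₄ * g14 - g16 + g17 + g18 + O₁₂₃ * g19
    - 2 * g49 := by
  simp only [relCasimir, g4, g5, g14, g16, g17, g18, g19, g49]
  ring

theorem relJ1_mem (i : Fin 6) : relJ1 i ∈ definingIdeal :=
  Ideal.subset_span (Or.inl (Or.inl (Or.inl ⟨i, rfl⟩)))

theorem relJ2_mem (i : Fin 6) : relJ2 i ∈ definingIdeal :=
  Ideal.subset_span (Or.inl (Or.inl (Or.inr ⟨i, rfl⟩)))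

theorem relJ3_mem (i : Fin 6) : relJ3 i ∈ definingIdeal :=
  Ideal.subset_span (Or.inl (Or.inr ⟨i, rfl⟩))

theorem relCasimir_mem : relCasimir ∈ definingIdeal := Ideal.subset_span (Or.inr rfl)

theorem mem_of_two_mul_eq {I : Ideal P} {f s : P} (h : 2 * f = s) (hs : s ∈ I) : f ∈ I := by
  have h2 : C (1 / 2 : ℂ) * 2 = (1 : P) := by
    rw [← map_ofNat C 2, ← C_mul]
    norm_num
  have : f = C (1 / 2 : ℂ) * s := by rw [← h, ← mul_assoc, h2, one_mul]
  exact this ▸ I.mul_mem_left _ hs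

theorem definingIdeal_le_span : definingIdeal ≤ Ideal.span (Set.range g) := by
  have hg : ∀ k, g k ∈ Ideal.span (Set.range g) := fun k => Ideal.subset_span ⟨k, rfl⟩
  have two_mul_mem : ∀ {f : P}, f ∈ Ideal.span (Set.range g) → 2 * f ∈ Ideal.span (Set.range g) :=
    fun h => Ideal.mul_mem_left _ _ h
  refine Ideal.span_le.2 ?_
  rintro _ (((⟨i, rfl⟩ | ⟨i, rfl⟩) | ⟨i, rfl⟩) | rfl)
  · fin_cases i
    · exact relJ1_0 ▸ neg_mem (hg 3)
    · exact relJ1_1 ▸ neg_mem (hg 2)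
    · exact relJ1_2 ▸ neg_mem (hg 0)
    · exact relJ1_3 ▸ neg_mem (hg 1)
    · exact relJ1_4 ▸ neg_mem (hg 5)
    · exact relJ1_5 ▸ neg_mem (hg 4)
  · fin_cases i
    · exact relJ2_0 ▸ hg 11
    · exact relJ2_1 ▸ hg 9
    · exact relJ2_2 ▸ hg 13
    · exact relJ2_3 ▸ hg 12
    · exact relJ2_4 ▸ hg 10
    · exact relJ2_5 ▸ hg 14
  · fin_cases i
    · exact relJ3_0 ▸ hg 20
    · exact relJ3_1 ▸ add_mem (hg 18) (two_mul_mem (hg 8))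
    · exact relJ3_2 ▸ add_mem (hg 19) (two_mul_mem (hg 7))
    · exact relJ3_3 ▸ add_mem (hg 20) (two_mul_mem (hg 6))
    · exact relJ3_4 ▸ hg 18
    · exact relJ3_5 ▸ hg 19
  · rw [relCasimir_eq]
    exact sub_mem (add_mem (add_mem (add_mem (sub_mem (add_mem (add_mem
      (Ideal.mul_mem_left _ _ (hg 3)) (Ideal.mul_mem_left _ _ (hg 4)))
      (Ideal.mul_mem_left _ _ (hg 13))) (hg 15)) (hg 16)) (hg 17))
      (Ideal.mul_mem_left _ _ (hg 18))) (two_mul_mem (hg 48))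

theorem g1_mem : g1 ∈ definingIdeal := neg_mem_iff.1 (relJ1_2 ▸ relJ1_mem 2)

theorem g2_mem : g2 ∈ definingIdeal := neg_mem_iff.1 (relJ1_3 ▸ relJ1_mem 3)

theorem g3_mem : g3 ∈ definingIdeal := neg_mem_iff.1 (relJ1_1 ▸ relJ1_mem 1)

theorem g4_mem : g4 ∈ definingIdeal := neg_mem_iff.1 (relJ1_0 ▸ relJ1_mem 0)

theorem g5_mem : g5 ∈ definingIdeal := neg_mem_iff.1 (relJ1_5 ▸ relJ1_mem 5)

theorem g6_mem : g6 ∈ definingIdeal := neg_mem_iff.1 (relJ1_4 ▸ relJ1_mem 4)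

theorem g19_mem : g19 ∈ definingIdeal := relJ3_4 ▸ relJ3_mem 4

theorem g20_mem : g20 ∈ definingIdeal := relJ3_5 ▸ relJ3_mem 5

theorem g21_mem : g21 ∈ definingIdeal := relJ3_0 ▸ relJ3_mem 0

theorem g7_mem : g7 ∈ definingIdeal :=
  mem_of_two_mul_eq (eq_sub_of_add_eq' relJ3_3.symm) (sub_mem (relJ3_mem 3) g21_mem)

theorem g8_mem : g8 ∈ definingIdeal :=
  mem_of_two_mul_eq (eq_sub_of_add_eq' relJ3_2.symm) (sub_mem (relJ3_mem 2) g20_mem)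

theorem g9_mem : g9 ∈ definingIdeal :=
  mem_of_two_mul_eq (eq_sub_of_add_eq' relJ3_1.symm) (sub_mem (relJ3_mem 1) g19_mem)

theorem g10_mem : g10 ∈ definingIdeal := relJ2_1 ▸ relJ2_mem 1

theorem g11_mem : g11 ∈ definingIdeal := relJ2_4 ▸ relJ2_mem 4

theorem g12_mem : g12 ∈ definingIdeal := relJ2_0 ▸ relJ2_mem 0

theorem g13_mem : g13 ∈ definingIdeal := relJ2_3 ▸ relJ2_mem 3

theorem g14_mem : g14 ∈ definingIdeal := relJ2_2 ▸ relJ2_mem 2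

theorem g15_mem : g15 ∈ definingIdeal := relJ2_5 ▸ relJ2_mem 5

theorem g16_mem : g16 ∈ definingIdeal := by
  have h : 2 * g16 = O₁ * g4 + O₆ * g5 + O₃₄ * g14 - O₃ * g1 - O₄ * g2 - O₆₁ * g15 := by
    simp only [g1, g2, g4, g5, g14, g15, g16]
    ring
  exact mem_of_two_mul_eq h (sub_mem (sub_mem (sub_mem (add_mem (add_mem (Ideal.mul_mem_left _ _
    g4_mem) (Ideal.mul_mem_left _ _ g5_mem)) (Ideal.mul_mem_left _ _ g14_mem)) (Ideal.mul_mem_left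
    _ _ g1_mem)) (Ideal.mul_mem_left _ _ g2_mem)) (Ideal.mul_mem_left _ _ g15_mem))

theorem g17_mem : g17 ∈ definingIdeal := by
  have h : 2 * g17 = O₆ * g5 + O₅ * g6 + O₂₃ * g10 - O₃ * g1 - O₂ * g3 - O₅₆ * g11 := by
    simp only [g1, g3, g5, g6, g10, g11, g17]
    ring
  exact mem_of_two_mul_eq h (sub_mem (sub_mem (sub_mem (add_mem (add_mem (Ideal.mul_mem_left _ _
    g5_mem) (Ideal.mul_mem_left _ _ g6_mem)) (Ideal.mul_mem_left _ _ g10_mem)) (Ideal.mul_mem_left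
    _ _ g1_mem)) (Ideal.mul_mem_left _ _ g3_mem)) (Ideal.mul_mem_left _ _ g11_mem))

theorem g18_mem : g18 ∈ definingIdeal := by
  have h : 2 * g18 = O₄ * g2 + O₅ * g6 + O₁₂ * g12 - O₂ * g3 - O₁ * g4 - O₄₅ * g13 := by
    simp only [g2, g3, g4, g6, g12, g13, g18]
    ring
  exact mem_of_two_mul_eq h (sub_mem (sub_mem (sub_mem (add_mem (add_mem (Ideal.mul_mem_left _ _
    g2_mem) (Ideal.mul_mem_left _ _ g6_mem)) (Ideal.mul_mem_left _ _ g12_mem)) (Ideal.mul_mem_left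
    _ _ g3_mem)) (Ideal.mul_mem_left _ _ g4_mem)) (Ideal.mul_mem_left _ _ g13_mem))

theorem g22_mem : g22 ∈ definingIdeal := by
  have h : 2 * g22 = O₃₄₅ * g1 + O₆ * g19 - O₅ * g2 - O₆₁ * g10 := by
    simp only [g1, g2, g10, g19, g22]
    ring
  exact mem_of_two_mul_eq h (sub_mem (sub_mem (add_mem (Ideal.mul_mem_left _ _ g1_mem)
    (Ideal.mul_mem_left _ _ g19_mem)) (Ideal.mul_mem_left _ _ g2_mem)) (Ideal.mul_mem_left _ _
    g10_mem))

theorem g23_mem : g23 ∈ definingIdeal := by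
  have h : 2 * g23 = O₁₂₃ * g1 + O₆ * g21 - O₁ * g3 - O₅₆ * g14 := by
    simp only [g1, g3, g14, g21, g23]
    ring
  exact mem_of_two_mul_eq h (sub_mem (sub_mem (add_mem (Ideal.mul_mem_left _ _ g1_mem)
    (Ideal.mul_mem_left _ _ g21_mem)) (Ideal.mul_mem_left _ _ g3_mem)) (Ideal.mul_mem_left _ _
    g14_mem))

theorem g24_mem : g24 ∈ definingIdeal := by
  have h : 2 * g24 = O₃₄₅ * g3 + O₅ * g20 - O₆ * g4 - O₄₅ * g10 := by
    simp only [g3, g4, g10, g20, g24]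
    ring
  exact mem_of_two_mul_eq h (sub_mem (sub_mem (add_mem (Ideal.mul_mem_left _ _ g3_mem)
    (Ideal.mul_mem_left _ _ g20_mem)) (Ideal.mul_mem_left _ _ g4_mem)) (Ideal.mul_mem_left _ _
    g10_mem))

theorem g25_mem : g25 ∈ definingIdeal := by
  have h : 2 * g25 = O₂₃₄ * g4 + O₄ * g19 - O₅ * g5 - O₃₄ * g12 := by
    simp only [g4, g5, g12, g19, g25]
    ring
  exact mem_of_two_mul_eq h (sub_mem (sub_mem (add_mem (Ideal.mul_mem_left _ _ g4_mem)
    (Ideal.mul_mem_left _ _ g19_mem)) (Ideal.mul_mem_left _ _ g5_mem)) (Ideal.mul_mem_left _ _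
    g12_mem))

theorem g26_mem : g26 ∈ definingIdeal := by
  have h : 2 * g26 = O₂₃₄ * g2 + O₁ * g19 - O₂ * g1 - O₆₁ * g13 := by
    simp only [g1, g2, g13, g19, g26]
    ring
  exact mem_of_two_mul_eq h (sub_mem (sub_mem (add_mem (Ideal.mul_mem_left _ _ g2_mem)
    (Ideal.mul_mem_left _ _ g19_mem)) (Ideal.mul_mem_left _ _ g1_mem)) (Ideal.mul_mem_left _ _
    g13_mem))

theorem g27_mem : g27 ∈ definingIdeal := by
  have h : 2 * g27 = O₃₄₅ * g6 + O₂ * g20 - O₃ * g2 - O₁₂ * g11 := by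
    simp only [g2, g6, g11, g20, g27]
    ring
  exact mem_of_two_mul_eq h (sub_mem (sub_mem (add_mem (Ideal.mul_mem_left _ _ g6_mem)
    (Ideal.mul_mem_left _ _ g20_mem)) (Ideal.mul_mem_left _ _ g2_mem)) (Ideal.mul_mem_left _ _
    g11_mem))

theorem g28_mem : g28 ∈ definingIdeal := by
  have h : 2 * g28 = O₁₂₃ * g2 + O₁ * g20 - O₆ * g6 - O₁₂ * g14 := by
    simp only [g2, g6, g14, g20, g28]
    ring
  exact mem_of_two_mul_eq h (sub_mem (sub_mem (add_mem (Ideal.mul_mem_left _ _ g2_mem)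
    (Ideal.mul_mem_left _ _ g20_mem)) (Ideal.mul_mem_left _ _ g6_mem)) (Ideal.mul_mem_left _ _
    g14_mem))

theorem g29_mem : g29 ∈ definingIdeal := by
  have h : 2 * g29 = O₂₃₄ * g6 + O₂ * g21 - O₁ * g5 - O₂₃ * g13 := by
    simp only [g5, g6, g13, g21, g29]
    ring
  exact mem_of_two_mul_eq h (sub_mem (sub_mem (add_mem (Ideal.mul_mem_left _ _ g6_mem)
    (Ideal.mul_mem_left _ _ g21_mem)) (Ideal.mul_mem_left _ _ g5_mem)) (Ideal.mul_mem_left _ _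
    g13_mem))

theorem g30_mem : g30 ∈ definingIdeal := by
  have h : 2 * g30 = 2 * O₁ * g1 + O₄₅ * g2 + O₆₁ * g20 - O₆ * g11 - O₃₄₅ * g14 := by
    simp only [g1, g2, g11, g14, g20, g30]
    ring
  exact mem_of_two_mul_eq h (sub_mem (sub_mem (add_mem (add_mem (Ideal.mul_mem_left _ _ g1_mem)
    (Ideal.mul_mem_left _ _ g2_mem)) (Ideal.mul_mem_left _ _ g20_mem)) (Ideal.mul_mem_left _ _
    g11_mem)) (Ideal.mul_mem_left _ _ g14_mem))

theorem g31_mem : g31 ∈ definingIdeal := by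
  have h : 2 * g31 = O₂₃ * g1 + 2 * O₆ * g2 + O₆₁ * g21 - O₁ * g12 - O₂₃₄ * g14 := by
    simp only [g1, g2, g12, g14, g21, g31]
    ring
  exact mem_of_two_mul_eq h (sub_mem (sub_mem (add_mem (add_mem (Ideal.mul_mem_left _ _ g1_mem)
    (Ideal.mul_mem_left _ _ g2_mem)) (Ideal.mul_mem_left _ _ g21_mem)) (Ideal.mul_mem_left _ _
    g12_mem)) (Ideal.mul_mem_left _ _ g14_mem))

theorem g32_mem : g32 ∈ definingIdeal := by
  have h : 2 * g32 = O₃₄ * g1 + 2 * O₆ * g3 + O₅₆ * g19 - O₂₃₄ * g10 - O₅ * g13 := by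
    simp only [g1, g3, g10, g13, g19, g32]
    ring
  exact mem_of_two_mul_eq h (sub_mem (sub_mem (add_mem (add_mem (Ideal.mul_mem_left _ _ g1_mem)
    (Ideal.mul_mem_left _ _ g3_mem)) (Ideal.mul_mem_left _ _ g19_mem)) (Ideal.mul_mem_left _ _
    g10_mem)) (Ideal.mul_mem_left _ _ g13_mem))

theorem g33_mem : g33 ∈ definingIdeal := by
  have h : 2 * g33 = 2 * O₅ * g1 + O₁₂ * g3 + O₅₆ * g20 - O₁₂₃ * g10 - O₆ * g15 := by
    simp only [g1, g3, g10, g15, g20, g33]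
    ring
  exact mem_of_two_mul_eq h (sub_mem (sub_mem (add_mem (add_mem (Ideal.mul_mem_left _ _ g1_mem)
    (Ideal.mul_mem_left _ _ g3_mem)) (Ideal.mul_mem_left _ _ g20_mem)) (Ideal.mul_mem_left _ _
    g10_mem)) (Ideal.mul_mem_left _ _ g15_mem))

theorem g34_mem : g34 ∈ definingIdeal := by
  have h : 2 * g34 = 2 * O₄ * g3 + O₆₁ * g4 + O₄₅ * g19 - O₅ * g11 - O₃₄₅ * g12 := by
    simp only [g3, g4, g11, g12, g19, g34]
    ring
  exact mem_of_two_mul_eq h (sub_mem (sub_mem (add_mem (add_mem (Ideal.mul_mem_left _ _ g3_mem)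
    (Ideal.mul_mem_left _ _ g4_mem)) (Ideal.mul_mem_left _ _ g19_mem)) (Ideal.mul_mem_left _ _
    g11_mem)) (Ideal.mul_mem_left _ _ g12_mem))

theorem g35_mem : g35 ∈ definingIdeal := by
  have h : 2 * g35 = O₂₃ * g3 + O₄₅ * g21 - O₁₂₃ * g12 - O₄ * g14 := by
    simp only [g3, g12, g14, g21, g35]
    ring
  exact mem_of_two_mul_eq h (sub_mem (sub_mem (add_mem (Ideal.mul_mem_left _ _ g3_mem)
    (Ideal.mul_mem_left _ _ g21_mem)) (Ideal.mul_mem_left _ _ g12_mem)) (Ideal.mul_mem_left _ _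
    g14_mem))

theorem g37_mem : g37 ∈ definingIdeal := by
  have h : 2 * g37 = O₁₂ * g4 + O₃₄ * g20 - O₃ * g10 - O₃₄₅ * g15 := by
    simp only [g4, g10, g15, g20, g37]
    ring
  exact mem_of_two_mul_eq h (sub_mem (sub_mem (add_mem (Ideal.mul_mem_left _ _ g4_mem)
    (Ideal.mul_mem_left _ _ g20_mem)) (Ideal.mul_mem_left _ _ g10_mem)) (Ideal.mul_mem_left _ _
    g15_mem))

theorem g38_mem : g38 ∈ definingIdeal := by
  have h : 2 * g38 = O₅₆ * g5 + O₃₄ * g21 - O₄ * g13 - O₂₃₄ * g15 := by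
    simp only [g5, g13, g15, g21, g38]
    ring
  exact mem_of_two_mul_eq h (sub_mem (sub_mem (add_mem (Ideal.mul_mem_left _ _ g5_mem)
    (Ideal.mul_mem_left _ _ g21_mem)) (Ideal.mul_mem_left _ _ g13_mem)) (Ideal.mul_mem_left _ _
    g15_mem))

theorem g41_mem : g41 ∈ definingIdeal := by
  have h : 2 * g41 = O₆₁ * g5 + O₂₃ * g19 - O₂₃₄ * g11 - O₂ * g12 := by
    simp only [g5, g11, g12, g19, g41]
    ring
  exact mem_of_two_mul_eq h (sub_mem (sub_mem (add_mem (Ideal.mul_mem_left _ _ g5_mem)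
    (Ideal.mul_mem_left _ _ g19_mem)) (Ideal.mul_mem_left _ _ g11_mem)) (Ideal.mul_mem_left _ _
    g12_mem))

theorem g42_mem : g42 ∈ definingIdeal := by
  have h : 2 * g42 = O₄₅ * g6 + O₂₃ * g20 - O₁₂₃ * g11 - O₃ * g14 := by
    simp only [g6, g11, g14, g20, g42]
    ring
  exact mem_of_two_mul_eq h (sub_mem (sub_mem (add_mem (Ideal.mul_mem_left _ _ g6_mem)
    (Ideal.mul_mem_left _ _ g20_mem)) (Ideal.mul_mem_left _ _ g11_mem)) (Ideal.mul_mem_left _ _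
    g14_mem))

theorem g45_mem : g45 ∈ definingIdeal := by
  have h : 2 * g45 = O₃₄ * g2 + O₁₂ * g19 - O₂ * g10 - O₃₄₅ * g13 := by
    simp only [g2, g10, g13, g19, g45]
    ring
  exact mem_of_two_mul_eq h (sub_mem (sub_mem (add_mem (Ideal.mul_mem_left _ _ g2_mem)
    (Ideal.mul_mem_left _ _ g19_mem)) (Ideal.mul_mem_left _ _ g10_mem)) (Ideal.mul_mem_left _ _
    g13_mem))

theorem g36_mem : g36 ∈ definingIdeal := by
  have h : g36 = (1 - O₆ ^ 2) * g7 + O₃ * g22 - O₆ * g23 := by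
    simp only [g7, g22, g23, g36]
    ring
  rw [h]
  exact sub_mem (add_mem (Ideal.mul_mem_left _ _ g7_mem) (Ideal.mul_mem_left _ _ g22_mem))
    (Ideal.mul_mem_left _ _ g23_mem)

theorem g39_mem : g39 ∈ definingIdeal := by
  have h : g39 = g8 + O₄ * g26 - O₁ * g25 := by
    simp only [g8, g25, g26, g39]
    ring
  rw [h]
  exact sub_mem (add_mem g8_mem (Ideal.mul_mem_left _ _ g26_mem)) (Ideal.mul_mem_left _ _ g25_mem)

theorem g40_mem : g40 ∈ definingIdeal := by
  have h : g40 = (1 - O₆ ^ 2) * g9 + O₃ * g23 - O₆ * g22 := by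
    simp only [g9, g22, g23, g40]
    ring
  rw [h]
  exact sub_mem (add_mem (Ideal.mul_mem_left _ _ g9_mem) (Ideal.mul_mem_left _ _ g23_mem))
    (Ideal.mul_mem_left _ _ g22_mem)

theorem g43_mem : g43 ∈ definingIdeal := by
  have h : g43 = g8 + O₂ * g27 - O₅ * g29 := by
    simp only [g8, g27, g29, g43]
    ring
  rw [h]
  exact sub_mem (add_mem g8_mem (Ideal.mul_mem_left _ _ g27_mem)) (Ideal.mul_mem_left _ _ g29_mem)

theorem g44_mem : g44 ∈ definingIdeal := by
  have h : g44 = O₂ * g24 - g7 - O₅ * g27 := by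
    simp only [g7, g24, g27, g44]
    ring
  rw [h]
  exact sub_mem (sub_mem (Ideal.mul_mem_left _ _ g24_mem) g7_mem) (Ideal.mul_mem_left _ _ g27_mem)

theorem g46_mem : g46 ∈ definingIdeal := by
  have h : g46 = g9 + O₁ * g26 - O₄ * g28 := by
    simp only [g9, g26, g28, g46]
    ring
  rw [h]
  exact sub_mem (add_mem g9_mem (Ideal.mul_mem_left _ _ g26_mem)) (Ideal.mul_mem_left _ _ g28_mem)

theorem g49_mem : g49 ∈ definingIdeal :=
  mem_of_two_mul_eq (s := O₁ * g4 + O₆ * g5 + O₃₄ * g14 - g16 + g17 + g18 + O₁₂₃ * g19 - relCasimir)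
    (by rw [relCasimir_eq]; ring)
    (sub_mem (add_mem (add_mem (add_mem (sub_mem (add_mem (add_mem
      (Ideal.mul_mem_left _ _ g4_mem) (Ideal.mul_mem_left _ _ g5_mem))
      (Ideal.mul_mem_left _ _ g14_mem)) g16_mem) g17_mem) g18_mem)
      (Ideal.mul_mem_left _ _ g19_mem)) relCasimir_mem)

theorem g50_mem : g50 ∈ definingIdeal := by
  have h : g50 = O₁ * g14 + g22 + O₄ * g30 - O₁ * O₄ * g1 - O₆₁ * g26 := by
    simp only [g1, g14, g22, g26, g30, g50]
    ring
  rw [h]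
  exact sub_mem (sub_mem (add_mem (add_mem (Ideal.mul_mem_left _ _ g14_mem) g22_mem)
    (Ideal.mul_mem_left _ _ g30_mem)) (Ideal.mul_mem_left _ _ g1_mem)) (Ideal.mul_mem_left _ _
    g26_mem)

theorem g51_mem : g51 ∈ definingIdeal := by
  have h : g51 = (O₁ * O₂ - O₁₂) * g2 + g29 - O₆₁ * g18 := by
    simp only [g2, g18, g29, g51]
    ring
  rw [h]
  exact sub_mem (add_mem (Ideal.mul_mem_left _ _ g2_mem) g29_mem) (Ideal.mul_mem_left _ _ g18_mem)

theorem g53_mem : g53 ∈ definingIdeal := by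
  have h : g53 = (O₃ * O₄ - O₃₄) * g5 + O₄ * g8 + g26 - O₂₃ * g16 := by
    simp only [g5, g8, g16, g26, g53]
    ring
  rw [h]
  exact sub_mem (add_mem (add_mem (Ideal.mul_mem_left _ _ g5_mem) (Ideal.mul_mem_left _ _ g8_mem))
    g26_mem) (Ideal.mul_mem_left _ _ g16_mem)

theorem g55_mem : g55 ∈ definingIdeal := by
  have h : g55 = (O₂ * O₃ - O₂₃) * g5 + O₂ * g8 + g27 - O₃₄ * g17 := by
    simp only [g5, g8, g17, g27, g55]
    ring
  rw [h]
  exact sub_mem (add_mem (add_mem (Ideal.mul_mem_left _ _ g5_mem) (Ideal.mul_mem_left _ _ g8_mem))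
    g27_mem) (Ideal.mul_mem_left _ _ g17_mem)

theorem g57_mem : g57 ∈ definingIdeal := by
  have h : g57 = O₅ * g10 + g23 + O₂ * g33 - O₂ * O₅ * g1 - O₅₆ * g27 := by
    simp only [g1, g10, g23, g27, g33, g57]
    ring
  rw [h]
  exact sub_mem (sub_mem (add_mem (add_mem (Ideal.mul_mem_left _ _ g10_mem) g23_mem)
    (Ideal.mul_mem_left _ _ g33_mem)) (Ideal.mul_mem_left _ _ g1_mem)) (Ideal.mul_mem_left _ _
    g27_mem)

theorem g60_mem : g60 ∈ definingIdeal := by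
  have h : g60 = (O₁ * O₂ - O₁₂) * g6 + O₁ * g9 + g26 - O₂₃ * g18 := by
    simp only [g6, g9, g18, g26, g60]
    ring
  rw [h]
  exact sub_mem (add_mem (add_mem (Ideal.mul_mem_left _ _ g6_mem) (Ideal.mul_mem_left _ _ g9_mem))
    g26_mem) (Ideal.mul_mem_left _ _ g18_mem)

theorem g47_mem : g47 ∈ definingIdeal := by
  have h : 2 * g47 = O₂ * g3 + O₅₆ * g11 + O₃₄₅ * g21 + 2 * g49 - O₄ * g2 - O₆₁ * g15 - O₁₂₃ * g19
    := by
    simp only [g2, g3, g11, g15, g19, g21, g47, g49]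
    ring
  exact mem_of_two_mul_eq h (sub_mem (sub_mem (sub_mem (add_mem (add_mem (add_mem
    (Ideal.mul_mem_left _ _ g3_mem) (Ideal.mul_mem_left _ _ g11_mem)) (Ideal.mul_mem_left _ _
    g21_mem)) (Ideal.mul_mem_left _ _ g49_mem)) (Ideal.mul_mem_left _ _ g2_mem))
    (Ideal.mul_mem_left _ _ g15_mem)) (Ideal.mul_mem_left _ _ g19_mem))

theorem g48_mem : g48 ∈ definingIdeal := by
  have h : 2 * g48 = O₂ * g3 + O₁ * g4 + O₄₅ * g13 + O₂₃₄ * g20 + 2 * g49 - O₃ * g1 - O₄ * g2 -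
    O₆₁ * g15 - O₁₂₃ * g19 := by
    simp only [g1, g2, g3, g4, g13, g15, g19, g20, g48, g49]
    ring
  exact mem_of_two_mul_eq h (sub_mem (sub_mem (sub_mem (sub_mem (add_mem (add_mem (add_mem
    (add_mem (Ideal.mul_mem_left _ _ g3_mem) (Ideal.mul_mem_left _ _ g4_mem)) (Ideal.mul_mem_left
    _ _ g13_mem)) (Ideal.mul_mem_left _ _ g20_mem)) (Ideal.mul_mem_left _ _ g49_mem))
    (Ideal.mul_mem_left _ _ g1_mem)) (Ideal.mul_mem_left _ _ g2_mem)) (Ideal.mul_mem_left _ _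
    g15_mem)) (Ideal.mul_mem_left _ _ g19_mem))

theorem g58_mem : g58 ∈ definingIdeal := by
  have h : g58 = (O₆ ^ 2 - 1) * g18 + O₆ * g34 + g49 - O₂ * O₆ * g2 - O₁₂ * g23 := by
    simp only [g2, g18, g23, g34, g49, g58]
    ring
  rw [h]
  exact sub_mem (sub_mem (add_mem (add_mem (Ideal.mul_mem_left _ _ g18_mem) (Ideal.mul_mem_left _
    _ g34_mem)) g49_mem) (Ideal.mul_mem_left _ _ g2_mem)) (Ideal.mul_mem_left _ _ g23_mem)

theorem g59_mem : g59 ∈ definingIdeal := by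
  have h : g59 = O₄ * g42 + g49 - g16 - g17 - O₂₃ * g26 := by
    simp only [g16, g17, g26, g42, g49, g59]
    ring
  rw [h]
  exact sub_mem (sub_mem (sub_mem (add_mem (Ideal.mul_mem_left _ _ g42_mem) g49_mem) g16_mem)
    g17_mem) (Ideal.mul_mem_left _ _ g26_mem)

theorem g52_mem : g52 ∈ definingIdeal := by
  have h : g52 = O₆ * g34 + g47 - O₄ * O₆ * g3 - O₄₅ * g22 := by
    simp only [g3, g22, g34, g47, g52]
    ring
  rw [h]
  exact sub_mem (sub_mem (add_mem (Ideal.mul_mem_left _ _ g34_mem) g47_mem) (Ideal.mul_mem_left _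
    _ g3_mem)) (Ideal.mul_mem_left _ _ g22_mem)

theorem g54_mem : g54 ∈ definingIdeal := by
  have h : g54 = O₁ * g41 + g48 - g17 - g18 - O₂₃ * g26 := by
    simp only [g17, g18, g26, g41, g48, g54]
    ring
  rw [h]
  exact sub_mem (sub_mem (sub_mem (add_mem (Ideal.mul_mem_left _ _ g41_mem) g48_mem) g17_mem)
    g18_mem) (Ideal.mul_mem_left _ _ g26_mem)

theorem g56_mem : g56 ∈ definingIdeal := by
  have h : g56 = O₅ * g38 + g48 - g16 - O₃₄ * g27 := by
    simp only [g16, g27, g38, g48, g56]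
    ring
  rw [h]
  exact sub_mem (sub_mem (add_mem (Ideal.mul_mem_left _ _ g38_mem) g48_mem) g16_mem)
    (Ideal.mul_mem_left _ _ g27_mem)

theorem g61_mem : g61 ∈ definingIdeal := by
  have h : g61 = O₂ * g37 + g47 - g16 - g17 - g18 - O₃₄ * g27 := by
    simp only [g16, g17, g18, g27, g37, g47, g61]
    ring
  rw [h]
  exact sub_mem (sub_mem (sub_mem (sub_mem (add_mem (Ideal.mul_mem_left _ _ g37_mem) g47_mem)
    g16_mem) g17_mem) g18_mem) (Ideal.mul_mem_left _ _ g27_mem)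

theorem g_mem (k : Fin 61) : g k ∈ definingIdeal := by
  fin_cases k
  exacts [g1_mem, g2_mem, g3_mem, g4_mem, g5_mem, g6_mem, g7_mem, g8_mem, g9_mem, g10_mem, g11_mem,
    g12_mem, g13_mem, g14_mem, g15_mem, g16_mem, g17_mem, g18_mem, g19_mem, g20_mem, g21_mem,
    g22_mem, g23_mem, g24_mem, g25_mem, g26_mem, g27_mem, g28_mem, g29_mem, g30_mem, g31_mem,
    g32_mem, g33_mem, g34_mem, g35_mem, g36_mem, g37_mem, g38_mem, g39_mem, g40_mem, g41_mem,
    g42_mem, g43_mem, g44_mem, g45_mem, g46_mem, g47_mem, g48_mem, g49_mem, g50_mem, g51_mem,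
    g52_mem, g53_mem, g54_mem, g55_mem, g56_mem, g57_mem, g58_mem, g59_mem, g60_mem, g61_mem]

/-! ### Leading terms of the elements of the ideal -/

theorem leadingTerm_mem_span {f : P} (hf : f ∈ definingIdeal) :
    order.leadingTerm f ∈ Ideal.span (order.leadingTerm '' Set.range g) := by
  by_cases h0 : f = 0
  · rw [h0, order.leadingTerm_zero]
    exact Ideal.zero_mem _
  obtain ⟨i, hi⟩ := exists_degree_le_of_mem_span monic_g exists_sPoly_mem_lowerSpan
    (definingIdeal_le_span hf) h0
  have h : order.leadingTerm f =
      monomial (order.degree f - order.degree (g i)) (order.leadingCoeff f) *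
        order.leadingTerm (g i) := by
    rw [MonomialOrder.leadingTerm, MonomialOrder.leadingTerm, (monic_g i).leadingCoeff_eq_one,
      monomial_mul, mul_one, tsub_add_cancel_of_le hi]
  rw [h]
  exact Ideal.mul_mem_left _ _ (Ideal.subset_span ⟨g i, ⟨i, rfl⟩, rfl⟩)

end GenusTwo

theorem mainTheorem10 :
    IsNormalizedGroebnerBasis GenusTwo.order GenusTwo.definingIdeal GenusTwo.g where
  mem := GenusTwo.g_mem
  span_leadingTerm := by
    refine le_antisymm (Ideal.span_mono (Set.image_mono ?_)) (Ideal.span_le.2 ?_)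
    · rintro _ ⟨i, rfl⟩
      exact GenusTwo.g_mem i
    · rintro _ ⟨f, hf, rfl⟩
      exact GenusTwo.leadingTerm_mem_span hf
  monic := GenusTwo.monic_g
  reduced := GenusTwo.not_degree_le_of_mem_support
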